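/- A strongly unimodal sequence of size $n$ is a finite sequence of positive integers $\lambda=(\lambda_1,\dots,\lambda_s)$ with $\sum_j \lambda_j=n$ such that, for some $1\le k\le s$, $\lambda_1<\dots<\lambda_{k-1}<\lambda_k>\lambda_{k+1}>\dots>\lambda_s$. Let $\mathcal D(n)$ be the set of these sequences and $d(n)$ its cardinality. The diagram of $\lambda$ consists of $s$ adjacent columns of unit squares standing on the $x$-axis, the $j$-th column having $\lambda_j$ squares, placed so that the left edge of the peak column (the $k$-th) lies on the $y$-axis. The shape of $\lambda$ is the top border of the diagram, i.e. the staircase path made of the top edges of the columns and of the vertical segments joining consecutive heights, where the height is $0$ outside the diagram. The renormalized shape $\widetilde\varphi(\lambda)$ is obtained from the shape by rescaling both axes by $1/\sqrt n$. Let $$f_d(x)=-\frac{\sqrt6}{\pi}\log\left(e^{\frac{\pi}{\sqrt6}|x|}-1\right),\qquad 0<|x|\le\frac{\sqrt6}{\pi}\log 2,$$ and for $\epsilon>0$ let $N_\epsilon(f_d)$ be the set of points $(x,y)$ of the plane such that $|x-t|\le\epsilon$ for some $t$ with $0<|t|\le\frac{\sqrt6}{\pi}\log 2$ and $f_d(t)=y$,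 or $|y|<\epsilon$, or $|x|<\epsilon$ (the points at horizontal distance at most $\epsilon$ from the curve $y=f_d(x)$, together with the $\epsilon$-neighbourhoods of the two axes). Theorem. For every $\epsilon>0$, $$\lim_{n\to\infty}\frac{1}{d(n)}\cdot\#\left\{\lambda\in\mathcal D(n):\widetilde\varphi(\lambda)\subset N_\epsilon(f_d)\right\}=1 .$$ -/

import Mathlib

open Filter Topology

/-- A finite sequence of positive integers with sum `n` (a `Composition n`) is strongly unimodal
if it has a part, of index `k`, up to which it increases strictly and after which it decreases
strictly. (The empty sequence has no such `k`.) -/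
def IsStronglyUnimodal {n : ℕ} (c : Composition n) : Prop :=
  ∃ k : Fin c.length,
    StrictMonoOn c.blocksFun (Set.Iic k) ∧ StrictAntiOn c.blocksFun (Set.Ici k)

/-- The set `𝒟(n)` of strongly unimodal sequences of size `n`. -/
def stronglyUnimodal (n : ℕ) : Set (Composition n) :=
  {c | IsStronglyUnimodal c}

/-- The size of the peaks: the largest part. -/
def peakSize {n : ℕ} (c : Composition n) : ℕ :=
  Finset.univ.sup c.blocksFun

/-- The number of parts before the left-most peak. -/
def peakIndex {n : ℕ} (c : Composition n) : ℕ :=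
  c.blocks.idxOf (peakSize c)

/-- The shape of `c`: the top border of its diagram, from the `x`-axis up to the peak and down to
the `x`-axis again. Column `j` of the diagram (`0 ≤ j < s`, where `s` is the number of parts)
lies over `[j - p, j + 1 - p]`, with `p = peakIndex c`, so that the left edge of the left-most
peak column is on the `y`-axis. The shape consists of the top edges of the columns and of the
vertical segments over `i - p` (`0 ≤ i ≤ s`) joining the heights of the columns `i - 1` and `i`,
where the height is `0` outside the diagram. -/
def shape {n : ℕ} (c : Composition n) : Set (ℝ × ℝ) :=
  (⋃ j : Fin c.length,
    Set.Icc ((j : ℝ) - peakIndex c) ((j : ℝ) + 1 - peakIndex c) ×ˢ {(c.blocksFun j : ℝ)}) ∪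
  ⋃ i ∈ Finset.range (c.length + 1),
    {(i : ℝ) - peakIndex c} ×ˢ
      Set.uIcc (((0 :: c.blocks).getD i 0 : ℕ) : ℝ) ((c.blocks.getD i 0 : ℕ) : ℝ)

/-- The renormalized shape: both axes are rescaled by `1 / √n`. -/
noncomputable def renormalizedShape {n : ℕ} (c : Composition n) : Set (ℝ × ℝ) :=
  (fun p : ℝ × ℝ => (p.1 / √(n : ℝ), p.2 / √(n : ℝ))) '' shape c

/-- The set `N_ε(f)` for a function `f` on a subset `A` of `ℝ`: the points at horizontal distance
at most `ε` from the graph of `f` over `A`, together with the `ε`-neighbourhoods of the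
`x`-axis and of the `y`-axis. -/
def shapeNhd (A : Set ℝ) (f : ℝ → ℝ) (ε : ℝ) : Set (ℝ × ℝ) :=
  {p | ∃ t ∈ A, f t = p.2 ∧ |p.1 - t| ≤ ε} ∪ {p | |p.2| < ε} ∪ {p | |p.1| < ε}

/-- The domain of the limit curve. -/
noncomputable def limitCurveDomain : Set ℝ :=
  Set.Ico (-(√6 / Real.pi * Real.log 2)) 0 ∪ Set.Ioc 0 (√6 / Real.pi * Real.log 2)

/-- The limit curve `f_d`; only its values on `limitCurveDomain` matter. -/
noncomputable def limitCurve (x : ℝ) : ℝ :=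
  if x < 0 then -(√6 / Real.pi) * Real.log (Real.exp (-(Real.pi / √6) * x) - 1)
  else -(√6 / Real.pi) * Real.log (Real.exp (Real.pi / √6 * x) - 1)

/-!
A strongly unimodal sequence of size `n` is the same thing as a pair `(A, B)` of sets of positive
integers, the parts left and right of the peak, such that the peak `n - ∑ A - ∑ B` exceeds all
elements of `A` and `B` (`injOn_parts`, `exists_mem_stronglyUnimodal`). Up to an error of one unit
the shape at height `h` has the abscissas `-#{a ∈ A | h ≤ a}` and `#{a ∈ B | h ≤ a}`, or lies
within one unit of the vertical axis (`abs_le_one_or_of_mem_shape`). So it is enough that, for all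
but a vanishing proportion of the sequences, these counting functions divided by `√n` are uniformly
close to the inverse `y ↦ log (1 + e^{-cy}) / c` of the limit curve, where `c = π / √6`; by
monotonicity finitely many heights suffice (`abs_countGE_sub_le`).

Give the pair `(A, B)` the Boltzmann weight `e^{-b (∑ A + ∑ B)}`. The partition function is
`∏ (1 + e^{-bj})²`, with logarithm asymptotic to `c² / b` as `b → 0`
(`tendsto_mul_tsum_logOneAddExpNeg`, from `∑ 1 / k² = π² / 6`). With `b = c / √n`, the number of
pairs with sum at most `n` is at most `e^{bn}` times the weight, that is
`exp ((2 c + o(1)) √n)`, and Chernoff's inequality improves this by a factor `exp (-η √n)` for the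
pairs that deviate by `δ √n` at a given height (`exists_eventually_card_deviation_le`); the expected
counting function is a Riemann sum of `1 / (1 + eˣ)`, whose integral gives the limit curve. In the
other direction `d(n) ≥ exp ((2 c - o(1)) √n)` (`eventually_exp_le_ncard`): for `b` slightly above
`c / √n`, all but a small part of the weight lies on pairs with sum slightly below `n`, and the peak
can absorb the rest. Comparing the two bounds gives the theorem.
-/

/-! ### Strongly unimodal sequences as pairs of sets -/

/-- The number of elements of `S` that are at least `y`. -/
noncomputable def countGE (S : Finset ℕ) (y : ℝ) : ℕ :=
  (S.filter fun a : ℕ => y ≤ (a : ℝ)).card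

/-- The set of parts before the left-most peak. -/
def leftParts {n : ℕ} (c : Composition n) : Finset ℕ :=
  (c.blocks.take (peakIndex c)).toFinset

/-- The set of parts after the left-most peak. -/
def rightParts {n : ℕ} (c : Composition n) : Finset ℕ :=
  (c.blocks.drop (peakIndex c + 1)).toFinset

/-- `IsPeakSplit l₁ m l₂` says that the list `l₁ ++ m :: l₂` increases strictly up to the
entry `m` and decreases strictly from there on. -/
structure IsPeakSplit (l₁ : List ℕ) (m : ℕ) (l₂ : List ℕ) : Prop where
  left : l₁.Pairwise (· < ·)
  right : l₂.Pairwise (· > ·)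
  left_lt : ∀ a ∈ l₁, a < m
  right_lt : ∀ a ∈ l₂, a < m

theorem exists_isPeakSplit {n : ℕ} {c : Composition n} (hc : c ∈ stronglyUnimodal n) :
    ∃ l₁ m l₂, c.blocks = l₁ ++ m :: l₂ ∧ IsPeakSplit l₁ m l₂ := by
  obtain ⟨k, hk1, hk2⟩ := hc
  have hk : (k : ℕ) < c.blocks.length := k.2
  have mono : ∀ (i j : ℕ) (hi : i < c.blocks.length) (hj : j < c.blocks.length), i < j → j ≤ k →
      c.blocks[i] < c.blocks[j] := fun i j hi hj hij hjk =>
    hk1 (a := ⟨i, hi⟩) (b := ⟨j, hj⟩) (show i ≤ k by omega) hjk hij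
  have anti : ∀ (i j : ℕ) (hi : i < c.blocks.length) (hj : j < c.blocks.length), i < j → k ≤ i →
      c.blocks[j] < c.blocks[i] := fun i j hi hj hij hjk =>
    hk2 (a := ⟨i, hi⟩) (b := ⟨j, hj⟩) hjk (show (k : ℕ) ≤ j by omega) hij
  refine ⟨c.blocks.take k, c.blocks[(k : ℕ)], c.blocks.drop (k + 1), ?_, ?_, ?_, ?_, ?_⟩
  · rw [← List.drop_eq_getElem_cons, List.take_append_drop]
  · rw [List.pairwise_iff_getElem]
    intro i j hi hj hij
    simp only [List.length_take] at hi hj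
    simp only [List.getElem_take]
    exact mono _ _ _ _ hij (by omega)
  · rw [List.pairwise_iff_getElem]
    intro i j hi hj hij
    simp only [List.length_drop] at hi hj
    simp only [List.getElem_drop]
    exact anti _ _ _ _ (by omega) (by omega)
  · intro a ha
    obtain ⟨i, hi, rfl⟩ := List.mem_iff_getElem.1 ha
    simp only [List.length_take] at hi
    simp only [List.getElem_take]
    exact mono _ _ _ _ (by omega) le_rfl
  · intro a ha
    obtain ⟨i, hi, rfl⟩ := List.mem_iff_getElem.1 ha
    simp only [List.length_drop] at hi
    simp only [List.getElem_drop]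
    exact anti _ _ _ _ (by omega) le_rfl

theorem IsPeakSplit.mem_stronglyUnimodal {n : ℕ} {c : Composition n} {l₁ l₂ : List ℕ} {m : ℕ}
    (h : IsPeakSplit l₁ m l₂) (hc : c.blocks = l₁ ++ m :: l₂) : c ∈ stronglyUnimodal n := by
  have hlen : c.length = l₁.length + (l₂.length + 1) := by
    simp [Composition.length, hc]
  have hf : ∀ i : Fin c.length, c.blocksFun i = (l₁ ++ m :: l₂)[(i : ℕ)]'(by
      simpa [hlen] using i.2) := fun i => by
    simp [Composition.blocksFun, hc]
  have h1 := List.pairwise_iff_getElem.1 h.left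
  have h2 := List.pairwise_iff_getElem.1 h.right
  refine ⟨⟨l₁.length, by omega⟩, ?_, ?_⟩
  · intro i hi j hj hij
    have hi' : (i : ℕ) ≤ l₁.length := hi
    have hj' : (j : ℕ) ≤ l₁.length := hj
    have hij' : (i : ℕ) < j := hij
    rw [hf, hf, List.getElem_append_left (by omega)]
    rcases hj'.lt_or_eq with hj' | hj'
    · rw [List.getElem_append_left hj']
      exact h1 _ _ _ _ hij'
    · rw [List.getElem_append_right (by omega)]
      simpa [hj'] using h.left_lt _ (List.getElem_mem _)
  · intro i hi j hj hij
    have hi' : l₁.length ≤ (i : ℕ) := hi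
    have hj' : l₁.length ≤ (j : ℕ) := hj
    have hij' : (i : ℕ) < j := hij
    have hjl := j.2
    rw [hf, hf, List.getElem_append_right hj', List.getElem_append_right hi']
    rw [List.getElem_cons, dif_neg (by omega), List.getElem_cons]
    split_ifs with h0
    · exact h.right_lt _ (List.getElem_mem _)
    · exact h2 _ _ _ _ (by omega)

namespace IsPeakSplit

variable {n : ℕ} {c : Composition n} {l₁ l₂ : List ℕ} {m : ℕ}

theorem peakSize_eq (h : IsPeakSplit l₁ m l₂) (hc : c.blocks = l₁ ++ m :: l₂) :
    peakSize c = m := by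
  apply le_antisymm
  · refine Finset.sup_le fun i _ => ?_
    have hi : c.blocksFun i ∈ c.blocks := c.blocksFun_mem_blocks i
    rw [hc] at hi
    simp only [List.mem_append, List.mem_cons] at hi
    rcases hi with hi | hi | hi
    · exact (h.left_lt _ hi).le
    · exact hi.le
    · exact (h.right_lt _ hi).le
  · have hm : m ∈ c.blocks := by simp [hc]
    obtain ⟨i, hi, hm⟩ := List.mem_iff_getElem.1 hm
    calc m = c.blocksFun ⟨i, hi⟩ := hm.symm
      _ ≤ _ := Finset.le_sup (f := c.blocksFun) (Finset.mem_univ _)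

theorem peakIndex_eq (h : IsPeakSplit l₁ m l₂) (hc : c.blocks = l₁ ++ m :: l₂) :
    peakIndex c = l₁.length := by
  have hm : m ∉ l₁ := fun hm => (h.left_lt m hm).false
  rw [peakIndex, h.peakSize_eq hc, hc, List.idxOf_append_of_notMem hm]
  simp

theorem leftParts_eq (h : IsPeakSplit l₁ m l₂) (hc : c.blocks = l₁ ++ m :: l₂) :
    leftParts c = l₁.toFinset := by
  rw [leftParts, h.peakIndex_eq hc, hc]
  simp

theorem rightParts_eq (h : IsPeakSplit l₁ m l₂) (hc : c.blocks = l₁ ++ m :: l₂) :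
    rightParts c = l₂.toFinset := by
  rw [rightParts, h.peakIndex_eq hc, hc, ← List.drop_drop, List.drop_left, List.drop_one,
    List.tail_cons]

theorem nodup_left (h : IsPeakSplit l₁ m l₂) : l₁.Nodup := h.left.imp fun h => h.ne
theorem nodup_right (h : IsPeakSplit l₁ m l₂) : l₂.Nodup := h.right.imp fun h => h.ne'

theorem sum_add_sum_add (h : IsPeakSplit l₁ m l₂) (hc : c.blocks = l₁ ++ m :: l₂) :
    ∑ a ∈ leftParts c, a + ∑ a ∈ rightParts c, a + m = n := by
  have h1 : ∑ a ∈ l₁.toFinset, a = l₁.sum := by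
    simpa using List.sum_toFinset (fun a : ℕ => a) h.nodup_left
  have h2 : ∑ a ∈ l₂.toFinset, a = l₂.sum := by
    simpa using List.sum_toFinset (fun a : ℕ => a) h.nodup_right
  have h3 := c.blocks_sum
  rw [hc, List.sum_append, List.sum_cons] at h3
  rw [h.leftParts_eq hc, h.rightParts_eq hc, h1, h2]
  omega

end IsPeakSplit

/-- A strongly unimodal sequence of given size is determined by the sets of parts on the two
sides of its peak. -/
theorem injOn_parts (n : ℕ) :
    Set.InjOn (fun c : Composition n => (leftParts c, rightParts c)) (stronglyUnimodal n) := by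
  intro c hc c' hc' heq
  obtain ⟨l₁, m, l₂, e, h⟩ := exists_isPeakSplit hc
  obtain ⟨l₁', m', l₂', e', h'⟩ := exists_isPeakSplit hc'
  obtain ⟨hl, hr⟩ := Prod.mk.inj heq
  have hs := h.sum_add_sum_add e
  have hs' := h'.sum_add_sum_add e'
  rw [hl, hr] at hs
  obtain rfl : m = m' := by omega
  rw [h.leftParts_eq e, h'.leftParts_eq e'] at hl
  rw [h.rightParts_eq e, h'.rightParts_eq e'] at hr
  have h1 : l₁ = l₁' := by
    have hp : l₁.Perm l₁' := (List.perm_of_nodup_nodup_toFinset_eq h.nodup_left h'.nodup_left hl)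
    exact hp.eq_of_pairwise (fun a b _ _ h1 h2 => absurd h1 h2.asymm) h.left h'.left
  have h2 : l₂ = l₂' := by
    have hp : l₂.Perm l₂' := (List.perm_of_nodup_nodup_toFinset_eq h.nodup_right h'.nodup_right hr)
    exact hp.eq_of_pairwise (fun a b _ _ h1 h2 => absurd h1 h2.asymm) h.right h'.right
  apply Composition.ext
  rw [e, e', h1, h2]

theorem parts_subset {n : ℕ} (c : Composition n) :
    leftParts c ⊆ Finset.Icc 1 n ∧ rightParts c ⊆ Finset.Icc 1 n := by
  have key : ∀ a ∈ c.blocks, a ∈ Finset.Icc 1 n := fun a ha =>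
    Finset.mem_Icc.2 ⟨c.one_le_blocks ha, c.blocks_sum ▸ List.le_sum_of_mem ha⟩
  constructor
  · intro a ha
    exact key a (List.mem_of_mem_take (List.mem_toFinset.1 ha))
  · intro a ha
    exact key a (List.mem_of_mem_drop (List.mem_toFinset.1 ha))

theorem sum_parts_le {n : ℕ} {c : Composition n} (hc : c ∈ stronglyUnimodal n) :
    ∑ a ∈ leftParts c, a + ∑ a ∈ rightParts c, a ≤ n := by
  obtain ⟨l₁, m, l₂, e, h⟩ := exists_isPeakSplit hc
  have := h.sum_add_sum_add e
  omega

/-- Two sets of integers in `[1, K]` of total sum less than `n - K` are the sets of parts on the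
two sides of the peak of a sequence in `𝒟(n)`: the peak takes up the rest of the sum. -/
theorem exists_mem_stronglyUnimodal {n K : ℕ} {A B : Finset ℕ} (hA : A ⊆ Finset.Icc 1 K)
    (hB : B ⊆ Finset.Icc 1 K) (hn : ∑ a ∈ A, a + ∑ a ∈ B, a + K < n) :
    ∃ c ∈ stronglyUnimodal n, leftParts c = A ∧ rightParts c = B := by
  set m := n - (∑ a ∈ A, a + ∑ a ∈ B, a) with hm
  have hKm : K < m := by omega
  have hA' : ∀ a ∈ A, 1 ≤ a ∧ a ≤ K := fun a ha => Finset.mem_Icc.1 (hA ha)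
  have hB' : ∀ a ∈ B, 1 ≤ a ∧ a ≤ K := fun a ha => Finset.mem_Icc.1 (hB ha)
  have hsplit : IsPeakSplit (A.sort (· ≤ ·)) m (B.sort (· ≥ ·)) := by
    refine ⟨(Finset.sortedLT_sort A).pairwise, (Finset.sortedGT_sort B).pairwise, ?_, ?_⟩
    · intro a ha
      have := hA' a ((Finset.mem_sort _).1 ha)
      omega
    · intro a ha
      have := hB' a ((Finset.mem_sort _).1 ha)
      omega
  have hs1 : (A.sort (· ≤ ·)).sum = ∑ a ∈ A, a := by
    simpa using (List.sum_toFinset (fun a : ℕ => a) (Finset.sort_nodup A (· ≤ ·))).symm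
  have hs2 : (B.sort (· ≥ ·)).sum = ∑ a ∈ B, a := by
    simpa using (List.sum_toFinset (fun a : ℕ => a) (Finset.sort_nodup B (· ≥ ·))).symm
  let c : Composition n :=
    { blocks := A.sort (· ≤ ·) ++ m :: B.sort (· ≥ ·)
      blocks_pos := by
        intro i hi
        simp only [List.mem_append, List.mem_cons, Finset.mem_sort] at hi
        rcases hi with hi | hi | hi
        · exact (hA' i hi).1
        · omega
        · exact (hB' i hi).1
      blocks_sum := by
        rw [List.sum_append, List.sum_cons, hs1, hs2]
        omega }
  refine ⟨c, hsplit.mem_stronglyUnimodal rfl, ?_, ?_⟩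
  · rw [hsplit.leftParts_eq (c := c) rfl]; simp
  · rw [hsplit.rightParts_eq (c := c) rfl]; simp

/-! ### The counting functions of the parts and the shape -/

theorem countGE_toFinset {l : List ℕ} (h : l.Nodup) (y : ℝ) :
    countGE l.toFinset y = l.countP fun a : ℕ => decide (y ≤ (a : ℝ)) := by
  rw [countGE, List.countP_eq_length_filter, ← List.toFinset_card_of_nodup (h.filter _),
    List.toFinset_filter]
  congr 1
  ext a
  simp

theorem countGE_le_length_sub {l : List ℕ} (h : l.Nodup) {y : ℝ} {i : ℕ}
    (H : ∀ a ∈ l.take i, (a : ℝ) < y) : countGE l.toFinset y ≤ l.length - i := by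
  rw [countGE_toFinset h]
  nth_rw 1 [← List.take_append_drop i l]
  rw [List.countP_append, List.countP_eq_zero.2 fun a ha => by simpa using H a ha, zero_add]
  exact List.countP_le_length.trans (by simp)

theorem length_sub_le_countGE {l : List ℕ} (h : l.Nodup) {y : ℝ} {i : ℕ}
    (H : ∀ a ∈ l.drop i, y ≤ (a : ℝ)) : l.length - i ≤ countGE l.toFinset y := by
  rw [countGE_toFinset h]
  nth_rw 2 [← List.take_append_drop i l]
  rw [List.countP_append, (List.countP_eq_length (l := l.drop i)).2 fun a ha => by
    simpa using H a ha]
  simp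

theorem countGE_le_of_drop_lt {l : List ℕ} (h : l.Nodup) {y : ℝ} {i : ℕ}
    (H : ∀ a ∈ l.drop i, (a : ℝ) < y) : countGE l.toFinset y ≤ i := by
  rw [countGE_toFinset h]
  nth_rw 1 [← List.take_append_drop i l]
  rw [List.countP_append, (List.countP_eq_zero (l := l.drop i)).2 fun a ha => by
    simpa using H a ha, add_zero]
  exact List.countP_le_length.trans (by simp)

theorem le_countGE_of_le_take {l : List ℕ} (h : l.Nodup) {y : ℝ} {i : ℕ} (hi : i ≤ l.length)
    (H : ∀ a ∈ l.take i, y ≤ (a : ℝ)) : i ≤ countGE l.toFinset y := by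
  rw [countGE_toFinset h]
  nth_rw 1 [← List.take_append_drop i l]
  rw [List.countP_append, (List.countP_eq_length (l := l.take i)).2 fun a ha => by
    simpa using H a ha]
  simp [hi]

namespace IsPeakSplit

variable {n : ℕ} {c : Composition n} {l₁ l₂ : List ℕ} {m : ℕ}

theorem left_le_of_mem_drop (h : IsPeakSplit l₁ m l₂) {i : ℕ} (hi : i < l₁.length) {a : ℕ}
    (ha : a ∈ l₁.drop i) : l₁[i] ≤ a := by
  obtain ⟨k, hk, rfl⟩ := List.mem_iff_getElem.1 ha
  simp only [List.length_drop] at hk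
  rw [List.getElem_drop]
  rcases Nat.eq_zero_or_pos k with rfl | hk0
  · simp
  · exact (List.pairwise_iff_getElem.1 h.left _ _ _ _ (by omega)).le

theorem lt_left_of_mem_take (h : IsPeakSplit l₁ m l₂) {i : ℕ} (hi : i < l₁.length) {a : ℕ}
    (ha : a ∈ l₁.take i) : a < l₁[i] := by
  obtain ⟨k, hk, rfl⟩ := List.mem_iff_getElem.1 ha
  simp only [List.length_take] at hk
  rw [List.getElem_take]
  exact List.pairwise_iff_getElem.1 h.left _ _ _ _ (by omega)

theorem right_le_of_mem_take (h : IsPeakSplit l₁ m l₂) {i : ℕ} (hi : i < l₂.length) {a : ℕ}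
    (ha : a ∈ l₂.take (i + 1)) : l₂[i] ≤ a := by
  obtain ⟨k, hk, rfl⟩ := List.mem_iff_getElem.1 ha
  simp only [List.length_take] at hk
  rw [List.getElem_take]
  rcases (show k ≤ i by omega).eq_or_lt with rfl | hk0
  · rfl
  · exact (List.pairwise_iff_getElem.1 h.right _ _ _ _ hk0).le

theorem lt_right_of_mem_drop (h : IsPeakSplit l₁ m l₂) {i : ℕ} (hi : i < l₂.length) {a : ℕ}
    (ha : a ∈ l₂.drop (i + 1)) : a < l₂[i] := by
  obtain ⟨k, hk, rfl⟩ := List.mem_iff_getElem.1 ha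
  simp only [List.length_drop] at hk
  rw [List.getElem_drop]
  exact List.pairwise_iff_getElem.1 h.right _ _ _ _ (by omega)

end IsPeakSplit

/-- The horizontal segments of the shape, see `abs_le_one_or_of_mem_shape`. -/
theorem abs_le_one_or_of_mem_top {n : ℕ} {c : Composition n} (hc : c ∈ stronglyUnimodal n)
    (j : Fin c.length) {x y : ℝ} (hx : x ∈ Set.Icc ((j : ℝ) - peakIndex c) (j + 1 - peakIndex c))
    (hy : y = c.blocksFun j) :
    |x| ≤ 1 ∨ |x + countGE (leftParts c) y| ≤ 1 ∨ |x - countGE (rightParts c) y| ≤ 1 := by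
  obtain ⟨l₁, m, l₂, e, h⟩ := exists_isPeakSplit hc
  rw [h.peakIndex_eq e] at hx
  rw [h.leftParts_eq e, h.rightParts_eq e]
  have hjl : (j : ℕ) < l₁.length + (l₂.length + 1) := by
    simpa [Composition.length, e] using j.2
  have hf : c.blocksFun j = (l₁ ++ m :: l₂)[(j : ℕ)]'(by simpa using hjl) := by
    simp [Composition.blocksFun, e]
  rw [hf] at hy
  obtain ⟨hx1, hx2⟩ := hx
  rcases lt_trichotomy (j : ℕ) l₁.length with hj | hj | hj
  · rw [List.getElem_append_left hj] at hy
    have h1 := countGE_le_length_sub h.nodup_left (y := y) (i := j) fun a ha => by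
      rw [hy]; exact_mod_cast h.lt_left_of_mem_take hj ha
    have h2 := length_sub_le_countGE h.nodup_left (y := y) (i := j) fun a ha => by
      rw [hy]; exact_mod_cast h.left_le_of_mem_drop hj ha
    have h3 : countGE l₁.toFinset y + j = l₁.length := by omega
    have h4 : (countGE l₁.toFinset y : ℝ) + j = l₁.length := by exact_mod_cast h3
    exact Or.inr (Or.inl (abs_le.2 ⟨by linarith, by linarith⟩))
  · have h4 : ((j : ℕ) : ℝ) = l₁.length := by exact_mod_cast hj
    exact Or.inl (abs_le.2 ⟨by linarith, by linarith⟩)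
  · obtain ⟨i, hi⟩ := Nat.exists_eq_add_of_lt hj
    have hil : i < l₂.length := by omega
    have hy' : y = l₂[i] := by
      rw [hy, List.getElem_append_right hj.le]
      simp [hi, show l₁.length + i + 1 - l₁.length = i + 1 by omega]
    have h1 := le_countGE_of_le_take h.nodup_right (y := y) (i := i + 1) hil fun a ha => by
      rw [hy']; exact_mod_cast h.right_le_of_mem_take hil ha
    have h2 := countGE_le_of_drop_lt h.nodup_right (y := y) (i := i + 1) fun a ha => by
      rw [hy']; exact_mod_cast h.lt_right_of_mem_drop hil ha
    have h3 : countGE l₂.toFinset y + l₁.length = j := by omega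
    have h4 : (countGE l₂.toFinset y : ℝ) + l₁.length = j := by exact_mod_cast h3
    exact Or.inr (Or.inr (abs_le.2 ⟨by linarith, by linarith⟩))

/-- The vertical segments of the shape, see `abs_le_one_or_of_mem_shape`. -/
theorem abs_le_one_or_of_mem_vertical {n : ℕ} {c : Composition n} (hc : c ∈ stronglyUnimodal n)
    {i : ℕ} (hi : i ≤ c.length) {x y : ℝ} (hx : x = (i : ℝ) - peakIndex c)
    (hy : y ∈ Set.uIcc (((0 :: c.blocks).getD i 0 : ℕ) : ℝ) ((c.blocks.getD i 0 : ℕ) : ℝ)) :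
    |x| ≤ 1 ∨ |x + countGE (leftParts c) y| ≤ 1 ∨ |x - countGE (rightParts c) y| ≤ 1 := by
  obtain ⟨l₁, m, l₂, e, h⟩ := exists_isPeakSplit hc
  rw [h.peakIndex_eq e] at hx
  rw [h.leftParts_eq e, h.rightParts_eq e]
  have hil : i ≤ l₁.length + (l₂.length + 1) := by
    simpa [Composition.length, e] using hi
  rw [e] at hy
  rcases lt_or_ge i l₁.length with hj | hj
  · have e2 : (l₁ ++ m :: l₂).getD i 0 = l₁[i] := by
      rw [List.getD_append _ _ _ _ hj, List.getD_eq_getElem]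
    have h2 : y ≤ l₁[i] → l₁.length - i ≤ countGE l₁.toFinset y := fun hy' =>
      length_sub_le_countGE h.nodup_left (y := y) (i := i) fun a ha =>
        hy'.trans (by exact_mod_cast h.left_le_of_mem_drop hj ha)
    rw [e2] at hy
    have h5 : l₁.length - i ≤ countGE l₁.toFinset y ∧ countGE l₁.toFinset y ≤ l₁.length - i + 1 := by
      rcases Nat.eq_zero_or_pos i with rfl | hi0
      · rw [List.getD_cons_zero, Set.uIcc_of_le (Nat.cast_le.2 (Nat.zero_le _))] at hy
        refine ⟨h2 hy.2, ?_⟩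
        have := countGE_le_length_sub h.nodup_left (y := y) (i := 0) (by simp)
        omega
      · obtain ⟨k, rfl⟩ := Nat.exists_eq_add_of_le' hi0
        have hk : k < l₁.length := by omega
        rw [List.getD_cons_succ, List.getD_append _ _ _ _ hk, List.getD_eq_getElem _ _ hk,
          Set.uIcc_of_le (by
            exact_mod_cast (List.pairwise_iff_getElem.1 h.left _ _ hk hj (by omega)).le)] at hy
        refine ⟨h2 hy.2, ?_⟩
        have := countGE_le_length_sub h.nodup_left (y := y) (i := k) fun a ha =>
          lt_of_lt_of_le (by exact_mod_cast h.lt_left_of_mem_take hk ha) hy.1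
        omega
    have h6 : l₁.length ≤ countGE l₁.toFinset y + i ∧ countGE l₁.toFinset y + i ≤ l₁.length + 1 := by
      omega
    have h7 : (l₁.length : ℝ) ≤ countGE l₁.toFinset y + i ∧
      (countGE l₁.toFinset y : ℝ) + i ≤ l₁.length + 1 := by exact_mod_cast h6
    exact Or.inr (Or.inl (abs_le.2 ⟨by linarith, by linarith⟩))
  rcases le_or_gt i (l₁.length + 1) with hj' | hj'
  · have h8 : (l₁.length : ℝ) ≤ i ∧ (i : ℝ) ≤ l₁.length + 1 :=
      ⟨by exact_mod_cast hj, by exact_mod_cast hj'⟩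
    exact Or.inl (abs_le.2 ⟨by linarith, by linarith⟩)
  · obtain ⟨k, rfl⟩ := Nat.exists_eq_add_of_lt hj'
    have hk : k < l₂.length := by omega
    have e1 : (0 :: (l₁ ++ m :: l₂)).getD (l₁.length + 1 + k + 1) 0 = l₂[k] := by
      rw [List.getD_cons_succ, List.getD_append_right _ _ _ _ (by omega),
        show l₁.length + 1 + k - l₁.length = k + 1 by omega, List.getD_cons_succ,
        List.getD_eq_getElem]
    have e2 : (l₁ ++ m :: l₂).getD (l₁.length + 1 + k + 1) 0 = l₂.getD (k + 1) 0 := by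
      rw [List.getD_append_right _ _ _ _ (by omega),
        show l₁.length + 1 + k + 1 - l₁.length = k + 1 + 1 by omega, List.getD_cons_succ]
    rw [e1, e2] at hy
    have h2 : y ≤ l₂[k] → k + 1 ≤ countGE l₂.toFinset y := fun hy' =>
      le_countGE_of_le_take h.nodup_right hk fun a ha =>
        hy'.trans (by exact_mod_cast h.right_le_of_mem_take hk ha)
    have h5 : k + 1 ≤ countGE l₂.toFinset y ∧ countGE l₂.toFinset y ≤ k + 2 := by
      rcases (show k + 1 ≤ l₂.length from hk).eq_or_lt with hk' | hk'
      · rw [List.getD_eq_default _ _ hk'.ge, Set.uIcc_of_ge (Nat.cast_le.2 (Nat.zero_le _))] at hy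
        refine ⟨h2 hy.2, ?_⟩
        have := countGE_le_of_drop_lt h.nodup_right (y := y) (i := k + 1) (by simp [hk'])
        omega
      · rw [List.getD_eq_getElem _ _ hk', Set.uIcc_of_ge (by
            exact_mod_cast (List.pairwise_iff_getElem.1 h.right _ _ hk hk' (by omega)).le)] at hy
        refine ⟨h2 hy.2, ?_⟩
        exact countGE_le_of_drop_lt h.nodup_right (y := y) (i := k + 2) fun a ha =>
          lt_of_lt_of_le (by exact_mod_cast h.lt_right_of_mem_drop hk' ha) hy.1
    have h7 : (k : ℝ) + 1 ≤ countGE l₂.toFinset y ∧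
      (countGE l₂.toFinset y : ℝ) ≤ k + 2 := by exact_mod_cast h5
    push_cast at hx
    exact Or.inr (Or.inr (abs_le.2 ⟨by linarith, by linarith⟩))

/-- The abscissas of the shape at height `y` are, up to `1`, minus the number of parts `≥ y` left
of the peak and the number of parts `≥ y` right of the peak. -/
theorem abs_le_one_or_of_mem_shape {n : ℕ} {c : Composition n} (hc : c ∈ stronglyUnimodal n)
    {x y : ℝ} (hxy : (x, y) ∈ shape c) :
    |x| ≤ 1 ∨ |x + countGE (leftParts c) y| ≤ 1 ∨ |x - countGE (rightParts c) y| ≤ 1 := by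
  rcases hxy with hxy | hxy
  · obtain ⟨j, hj⟩ := Set.mem_iUnion.1 hxy
    exact abs_le_one_or_of_mem_top hc j hj.1 hj.2
  · simp only [Set.mem_iUnion] at hxy
    obtain ⟨i, hi, hj⟩ := hxy
    exact abs_le_one_or_of_mem_vertical hc (by simpa [Nat.lt_succ_iff] using hi) hj.1 hj.2

theorem nonneg_of_mem_shape {n : ℕ} {c : Composition n} {x y : ℝ} (hxy : (x, y) ∈ shape c) :
    0 ≤ y := by
  rcases hxy with hxy | hxy
  · obtain ⟨j, hj⟩ := Set.mem_iUnion.1 hxy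
    have hy : y = c.blocksFun j := hj.2
    rw [hy]
    positivity
  · simp only [Set.mem_iUnion] at hxy
    obtain ⟨i, -, hj⟩ := hxy
    have hy := hj.2.1
    exact le_trans (le_inf (Nat.cast_nonneg _) (Nat.cast_nonneg _)) hy

/-! ### The function `log (1 + e⁻ˣ)` -/

/-- The function `φ(x) = log (1 + e⁻ˣ)`, an antiderivative of `-1 / (1 + eˣ)`. -/
noncomputable def logOneAddExpNeg (x : ℝ) : ℝ := Real.log (1 + Real.exp (-x))

theorem logOneAddExpNeg_nonneg (x : ℝ) : 0 ≤ logOneAddExpNeg x :=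
  Real.log_nonneg (by linarith [Real.exp_pos (-x)])

theorem logOneAddExpNeg_le (x : ℝ) : logOneAddExpNeg x ≤ Real.exp (-x) := by
  have := Real.log_le_sub_one_of_pos (show 0 < 1 + Real.exp (-x) by positivity)
  simpa [logOneAddExpNeg] using this

theorem antitone_logOneAddExpNeg : Antitone logOneAddExpNeg := fun x y h => by
  unfold logOneAddExpNeg
  gcongr

/-- The graph of the convex function `φ` lies above its tangents. -/
theorem logOneAddExpNeg_sub_le (x h : ℝ) :
    logOneAddExpNeg x - h * (1 / (1 + Real.exp x)) ≤ logOneAddExpNeg (x + h) := by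
  set p := 1 / (1 + Real.exp x) with hp
  have hx := Real.exp_pos x
  have hp0 : 0 ≤ p := by positivity
  have hp1 : p ≤ 1 := by rw [hp, div_le_one (by positivity)]; linarith
  have key : Real.exp (-(h * p)) ≤ 1 - p + p * Real.exp (-h) := by
    have := convexOn_exp.2 (Set.mem_univ 0) (Set.mem_univ (-h)) (sub_nonneg.2 hp1) hp0 (by ring)
    simp only [smul_eq_mul, mul_zero, zero_add, Real.exp_zero, mul_one] at this
    rwa [show -(h * p) = p * -h by ring]
  have e : 1 + Real.exp (-(x + h)) = (1 + Real.exp (-x)) * (1 - p + p * Real.exp (-h)) := by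
    rw [hp, neg_add, Real.exp_add, Real.exp_neg x]
    field_simp
    ring
  unfold logOneAddExpNeg
  rw [e, Real.log_mul (by positivity) ((Real.exp_pos _).trans_le key).ne']
  have := Real.log_le_log (Real.exp_pos _) key
  rw [Real.log_exp] at this
  linarith

theorem logOneAddExpNeg_sub_le_self (x : ℝ) {h : ℝ} (hh : 0 ≤ h) :
    logOneAddExpNeg x - h ≤ logOneAddExpNeg (x + h) := by
  refine le_trans ?_ (logOneAddExpNeg_sub_le x h)
  have : 1 / (1 + Real.exp x) ≤ 1 := by
    rw [div_le_one (by positivity)]; linarith [Real.exp_pos x]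
  nlinarith

/-- Upper bound for a Riemann sum of `1 / (1 + eˣ)`, by telescoping. -/
theorem mul_sum_Ico_le (b : ℝ) {m n : ℕ} (hmn : m ≤ n) :
    b * ∑ j ∈ Finset.Ico m n, 1 / (1 + Real.exp (b * j)) ≤ logOneAddExpNeg (b * (m - 1)) := by
  have h : ∀ j ∈ Finset.Ico m n, b * (1 / (1 + Real.exp (b * j))) ≤
      -logOneAddExpNeg (b * ((j + 1 : ℕ) - 1)) - -logOneAddExpNeg (b * (j - 1)) := by
    intro j _
    have := logOneAddExpNeg_sub_le (b * j) (-b)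
    rw [show b * j + -b = b * (j - 1) by ring] at this
    push_cast
    rw [add_sub_cancel_right]
    linarith
  rw [Finset.mul_sum]
  refine (Finset.sum_le_sum h).trans ?_
  rw [Finset.sum_Ico_sub (fun j : ℕ => -logOneAddExpNeg (b * ((j : ℝ) - 1))) hmn]
  linarith [logOneAddExpNeg_nonneg (b * ((n : ℝ) - 1))]

/-- Lower bound for a Riemann sum of `1 / (1 + eˣ)`, by telescoping. -/
theorem le_mul_sum_Ico (b : ℝ) {m n : ℕ} (hmn : m ≤ n) :
    logOneAddExpNeg (b * m) - logOneAddExpNeg (b * n) ≤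
      b * ∑ j ∈ Finset.Ico m n, 1 / (1 + Real.exp (b * j)) := by
  have h : ∀ j ∈ Finset.Ico m n, -logOneAddExpNeg (b * (j + 1 : ℕ)) - -logOneAddExpNeg (b * j) ≤
      b * (1 / (1 + Real.exp (b * j))) := by
    intro j _
    have := logOneAddExpNeg_sub_le (b * j) b
    rw [show b * j + b = b * (j + 1 : ℕ) by push_cast; ring] at this
    linarith
  rw [Finset.mul_sum]
  refine le_trans ?_ (Finset.sum_le_sum h)
  rw [Finset.sum_Ico_sub (fun j : ℕ => -logOneAddExpNeg (b * (j : ℝ))) hmn]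
  linarith

/-! ### Asymptotics of the logarithm of the partition function -/

theorem summable_one_div_succ_sq : Summable fun k : ℕ => 1 / ((k : ℝ) + 1) ^ 2 := by
  simpa using (summable_nat_add_iff 1).2 hasSum_zeta_two.summable

theorem one_div_mul_exp_sub_one_le {b : ℝ} (hb : 0 < b) (k : ℕ) :
    1 / ((k + 1) * (Real.exp (b * (k + 1)) - 1)) ≤ 1 / b * (1 / ((k : ℝ) + 1) ^ 2) := by
  have h1 : b * ((k : ℝ) + 1) ≤ Real.exp (b * (k + 1)) - 1 := by
    linarith [Real.add_one_le_exp (b * ((k : ℝ) + 1))]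
  rw [one_div_mul_one_div]
  refine one_div_le_one_div_of_le (by positivity) ?_
  calc b * ((k : ℝ) + 1) ^ 2 = (k + 1) * (b * (k + 1)) := by ring
    _ ≤ _ := by gcongr

/-- The sum of `-log (1 - e^{-bj})` over `j ≥ 1`, as a single series in `1 / (e^{bk} - 1)`. -/
theorem hasSum_neg_log_one_sub_exp {b : ℝ} (hb : 0 < b) :
    HasSum (fun j : ℕ => -Real.log (1 - Real.exp (-(b * (j + 1)))))
      (∑' k : ℕ, 1 / ((k + 1) * (Real.exp (b * (k + 1)) - 1))) := by
  let f : ℕ → ℕ → ℝ := fun j k => Real.exp (-(b * (j + 1))) ^ (k + 1) / (k + 1)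
  have hrow : ∀ j : ℕ, HasSum (fun k => f j k) (-Real.log (1 - Real.exp (-(b * (j + 1))))) := by
    intro j
    have hlt : |Real.exp (-(b * ((j : ℝ) + 1)))| < 1 := by
      rw [abs_of_pos (Real.exp_pos _), Real.exp_lt_one_iff]
      have : 0 < b * ((j : ℝ) + 1) := by positivity
      linarith
    exact Real.hasSum_pow_div_log_of_abs_lt_one hlt
  have hcol : ∀ k : ℕ, HasSum (fun j => f j k)
      (1 / ((k + 1) * (Real.exp (b * (k + 1)) - 1))) := by
    intro k
    have hpos : 0 < b * ((k : ℝ) + 1) := by positivity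
    have h1 : Real.exp (-(b * ((k : ℝ) + 1))) < 1 := by
      rw [Real.exp_lt_one_iff]; linarith
    have h2 : 1 < Real.exp (b * ((k : ℝ) + 1)) := by
      rwa [Real.one_lt_exp_iff]
    have h0 := ((hasSum_geometric_of_lt_one (Real.exp_pos _).le h1).mul_left
      (Real.exp (-(b * ((k : ℝ) + 1))) / (k + 1)))
    have e1 : Real.exp (-(b * ((k : ℝ) + 1))) / (k + 1) * (1 - Real.exp (-(b * ((k : ℝ) + 1))))⁻¹ =
        1 / ((k + 1) * (Real.exp (b * (k + 1)) - 1)) := by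
      rw [Real.exp_neg]
      have h3 : Real.exp (b * ((k : ℝ) + 1)) - 1 ≠ 0 := by linarith
      have h4 : 1 - (Real.exp (b * ((k : ℝ) + 1)))⁻¹ ≠ 0 := by
        rw [← Real.exp_neg]; linarith
      field_simp
    rw [e1] at h0
    refine h0.congr_fun fun j => ?_
    simp only [f]
    rw [← Real.exp_nat_mul, ← Real.exp_nat_mul, div_mul_eq_mul_div, ← Real.exp_add]
    congr 2
    push_cast
    ring
  have hsum : Summable fun p : ℕ × ℕ => f p.2 p.1 := by
    refine (summable_prod_of_nonneg fun p => ?_).2 ⟨fun k => (hcol k).summable, ?_⟩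
    · simp only [f, Pi.zero_apply]; positivity
    · simp only [(hcol _).tsum_eq]
      refine Summable.of_nonneg_of_le (fun k => ?_) (one_div_mul_exp_sub_one_le hb)
        (summable_one_div_succ_sq.mul_left (1 / b))
      have : 0 ≤ Real.exp (b * ((k : ℝ) + 1)) - 1 := by
        rw [sub_nonneg, Real.one_le_exp_iff]; positivity
      positivity
  have htot := hsum.hasSum.prod_fiberwise hcol
  have hsum' : Summable fun p : ℕ × ℕ => f p.1 p.2 := hsum.prod_symm
  have htot' := hsum'.hasSum.prod_fiberwise hrow
  have heq : ∑' p : ℕ × ℕ, f p.1 p.2 = ∑' p : ℕ × ℕ, f p.2 p.1 :=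
    (Equiv.prodComm ℕ ℕ).tsum_eq fun p : ℕ × ℕ => f p.2 p.1
  rw [htot.tsum_eq, ← heq]
  exact htot'

theorem tendsto_mul_tsum_one_div_exp_sub_one :
    Tendsto (fun b : ℝ => b * ∑' k : ℕ, 1 / ((k + 1) * (Real.exp (b * (k + 1)) - 1)))
      (𝓝[>] 0) (𝓝 (Real.pi ^ 2 / 6)) := by
  have hz : ∑' k : ℕ, 1 / ((k : ℝ) + 1) ^ 2 = Real.pi ^ 2 / 6 := by
    have := (hasSum_nat_add_iff' 1).2 hasSum_zeta_two
    simpa using this.tsum_eq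
  simp_rw [← tsum_mul_left]
  rw [← hz]
  refine tendsto_tsum_of_dominated_convergence summable_one_div_succ_sq (fun k => ?_) ?_
  · have hd : HasDerivAt (fun b : ℝ => Real.exp (b * (k + 1))) ((k : ℝ) + 1) 0 := by
      have := ((hasDerivAt_id (0 : ℝ)).mul_const ((k : ℝ) + 1)).exp
      simpa using this
    have hs := (hd.tendsto_slope.mono_left (nhdsWithin_mono _
      (fun x (hx : 0 < x) => hx.ne'))).inv₀ (by positivity)
    have hk : ((k : ℝ) + 1) ≠ 0 := by positivity
    have := hs.mul_const (1 / ((k : ℝ) + 1))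
    rw [show ((k : ℝ) + 1)⁻¹ * (1 / (k + 1)) = 1 / ((k : ℝ) + 1) ^ 2 by field_simp] at this
    refine this.congr' ?_
    filter_upwards [self_mem_nhdsWithin] with b hb
    rw [slope_def_field]
    simp only [zero_mul, Real.exp_zero, sub_zero, inv_div]
    rw [div_mul_div_comm, mul_one_div, mul_comm ((k : ℝ) + 1), mul_one]
  · filter_upwards [self_mem_nhdsWithin] with b hb k
    have hb : 0 < b := hb
    have h0 : 0 ≤ Real.exp (b * ((k : ℝ) + 1)) - 1 := by
      rw [sub_nonneg, Real.one_le_exp_iff]; positivity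
    rw [Real.norm_of_nonneg (by positivity)]
    have := mul_le_mul_of_nonneg_left (one_div_mul_exp_sub_one_le hb k) hb.le
    refine this.trans (le_of_eq ?_)
    field_simp

/-- The identity `1 + q = (1 - q ^ 2) / (1 - q)` for `q = e^{-bj}`, summed over `j`. -/
theorem hasSum_logOneAddExpNeg {b : ℝ} (hb : 0 < b) :
    HasSum (fun j : ℕ => logOneAddExpNeg (b * (j + 1)))
      (∑' k : ℕ, 1 / ((k + 1) * (Real.exp (b * (k + 1)) - 1)) -
        ∑' k : ℕ, 1 / ((k + 1) * (Real.exp (2 * b * (k + 1)) - 1))) := by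
  refine ((hasSum_neg_log_one_sub_exp hb).sub
    (hasSum_neg_log_one_sub_exp (b := 2 * b) (by positivity))).congr_fun fun j => ?_
  have h1 : Real.exp (-(b * ((j : ℝ) + 1))) < 1 := by
    have : 0 < b * ((j : ℝ) + 1) := by positivity
    rw [Real.exp_lt_one_iff]; linarith
  have h2 : 1 - Real.exp (-(2 * b * ((j : ℝ) + 1))) =
      (1 - Real.exp (-(b * ((j : ℝ) + 1)))) * (1 + Real.exp (-(b * ((j : ℝ) + 1)))) := by
    rw [show -(2 * b * ((j : ℝ) + 1)) = -(b * (j + 1)) + -(b * (j + 1)) by ring, Real.exp_add]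
    ring
  rw [h2, Real.log_mul (by linarith) (by positivity), logOneAddExpNeg]
  ring

/-- The asymptotics of `∑_{j ≥ 1} log (1 + e^{-bj})` as `b → 0`: the sum behaves like
`∫₀^∞ log (1 + e^{-bx}) dx = π² / (12 b)`. -/
theorem tendsto_mul_tsum_logOneAddExpNeg :
    Tendsto (fun b : ℝ => b * ∑' j : ℕ, logOneAddExpNeg (b * (j + 1)))
      (𝓝[>] 0) (𝓝 (Real.pi ^ 2 / 12)) := by
  have h1 := tendsto_mul_tsum_one_div_exp_sub_one
  have h2 : Tendsto (fun b : ℝ => 2 * b) (𝓝[>] 0) (𝓝[>] 0) := by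
    refine tendsto_nhdsWithin_iff.2 ⟨?_, ?_⟩
    · have : Tendsto (fun b : ℝ => 2 * b) (𝓝 0) (𝓝 (2 * 0)) := tendsto_id.const_mul 2
      rw [mul_zero] at this
      exact this.mono_left nhdsWithin_le_nhds
    · filter_upwards [self_mem_nhdsWithin] with b hb
      exact mul_pos two_pos (Set.mem_Ioi.1 hb)
  have h3 := h1.sub ((h1.comp h2).mul_const (1 / 2))
  rw [show Real.pi ^ 2 / 6 - Real.pi ^ 2 / 6 * (1 / 2) = Real.pi ^ 2 / 12 by ring] at h3
  refine h3.congr' ?_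
  filter_upwards [self_mem_nhdsWithin] with b hb
  rw [(hasSum_logOneAddExpNeg hb).tsum_eq]
  simp only [Function.comp]
  ring

/-! ### Scaling limits -/

/-- The constant `π / √6`. -/
noncomputable def shapeConst : ℝ := Real.pi / √6

theorem shapeConst_pos : 0 < shapeConst := by
  have := Real.pi_pos
  unfold shapeConst
  positivity

theorem shapeConst_sq : shapeConst ^ 2 = Real.pi ^ 2 / 6 := by
  rw [shapeConst, div_pow, Real.sq_sqrt (by norm_num)]

/-- The function `y ↦ log (1 + e^{-cy}) / c`, `c = π / √6`, inverse to the right branch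
of the limit curve: the half-width of the limit shape at height `y`. -/
noncomputable def halfWidth (y : ℝ) : ℝ := logOneAddExpNeg (shapeConst * y) / shapeConst

theorem halfWidth_nonneg (y : ℝ) : 0 ≤ halfWidth y :=
  div_nonneg (logOneAddExpNeg_nonneg _) shapeConst_pos.le

theorem tendsto_sqrt_natCast_atTop : Tendsto (fun n : ℕ => √(n : ℝ)) atTop atTop :=
  Real.tendsto_sqrt_atTop.comp tendsto_natCast_atTop_atTop

theorem sum_Icc_one_eq_sum_range (f : ℕ → ℝ) (K : ℕ) :
    ∑ j ∈ Finset.Icc 1 K, f j = ∑ j ∈ Finset.range K, f (j + 1) := by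
  have : Finset.Icc 1 K = Finset.Ico (0 + 1) (K + 1) := by ext; simp
  rw [this, ← Finset.sum_Ico_add', Finset.range_eq_Ico]

theorem tendsto_tsum_logOneAddExpNeg_div_sqrt {β : ℝ} (hβ : 0 < β) :
    Tendsto (fun n : ℕ => (∑' j : ℕ, logOneAddExpNeg (β / √(n : ℝ) * (j + 1))) / √(n : ℝ))
      atTop (𝓝 (shapeConst ^ 2 / (2 * β))) := by
  have h1 : Tendsto (fun n : ℕ => β / √(n : ℝ)) atTop (𝓝[>] 0) := by
    refine tendsto_nhdsWithin_iff.2 ⟨tendsto_sqrt_natCast_atTop.const_div_atTop β, ?_⟩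
    filter_upwards [eventually_gt_atTop 0] with n hn
    have : 0 < √(n : ℝ) := Real.sqrt_pos.2 (by exact_mod_cast hn)
    exact div_pos hβ this
  have h2 := (tendsto_mul_tsum_logOneAddExpNeg.comp h1).mul_const (1 / β)
  rw [shapeConst_sq, show Real.pi ^ 2 / 6 / (2 * β) = Real.pi ^ 2 / 12 * (1 / β) by
    field_simp; norm_num]
  refine h2.congr fun n => ?_
  simp only [Function.comp]
  field_simp

theorem eventually_sum_logOneAddExpNeg_le {β η : ℝ} (hβ : 0 < β) (hη : 0 < η) :
    ∀ᶠ n : ℕ in atTop, ∀ K : ℕ, ∑ j ∈ Finset.Icc 1 K, logOneAddExpNeg (β / √(n : ℝ) * j) ≤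
      (shapeConst ^ 2 / (2 * β) + η) * √(n : ℝ) := by
  filter_upwards [(tendsto_tsum_logOneAddExpNeg_div_sqrt hβ).eventually_le_const
    (lt_add_of_pos_right _ hη), eventually_gt_atTop 0] with n hn hn0 K
  have hs : 0 < √(n : ℝ) := Real.sqrt_pos.2 (by exact_mod_cast hn0)
  rw [div_le_iff₀ hs] at hn
  refine le_trans ?_ hn
  rw [sum_Icc_one_eq_sum_range]
  push_cast
  exact (hasSum_logOneAddExpNeg (div_pos hβ hs)).summable.sum_le_tsum _
    fun _ _ => logOneAddExpNeg_nonneg _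

theorem tsum_logOneAddExpNeg_le {b : ℝ} (hb : 0 < b) (K : ℕ) :
    ∑' j : ℕ, logOneAddExpNeg (b * (j + 1)) ≤
      ∑ j ∈ Finset.Icc 1 K, logOneAddExpNeg (b * j) + Real.exp (-(b * K)) / b := by
  have hsum := (hasSum_logOneAddExpNeg hb).summable
  rw [← hsum.sum_add_tsum_nat_add K, sum_Icc_one_eq_sum_range]
  push_cast
  refine add_le_add le_rfl ?_
  have h1 : Real.exp (-b) < 1 := by rw [Real.exp_lt_one_iff]; linarith
  have hg := (hasSum_geometric_of_lt_one (Real.exp_pos _).le h1).mul_left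
    (Real.exp (-(b * (K + 1))))
  have hle : ∑' j : ℕ, logOneAddExpNeg (b * (j + K + 1)) ≤
      Real.exp (-(b * (K + 1))) * (1 - Real.exp (-b))⁻¹ := by
    rw [← hg.tsum_eq]
    refine Summable.tsum_le_tsum (fun j => ?_) ?_ hg.summable
    · refine (logOneAddExpNeg_le _).trans (le_of_eq ?_)
      rw [← Real.exp_nat_mul, ← Real.exp_add]
      congr 1
      ring
    · have := (summable_nat_add_iff K).2 hsum
      push_cast at this
      exact this
  refine hle.trans ?_
  have h2 : Real.exp (-(b * (K + 1))) = Real.exp (-(b * K)) * Real.exp (-b) := by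
    rw [← Real.exp_add]; congr 1; ring
  have h3 : Real.exp (-b) * (1 - Real.exp (-b))⁻¹ ≤ 1 / b := by
    rw [← div_eq_mul_inv, div_le_div_iff₀ (by linarith) hb]
    have h4 : Real.exp (-b) * Real.exp b = 1 := by rw [← Real.exp_add]; simp
    have h5 := Real.add_one_le_exp b
    nlinarith [Real.exp_pos (-b)]
  rw [h2, mul_assoc, div_eq_mul_one_div]
  gcongr

/-- The parts may be restricted to `[1, θ n]` without loss in the leading order, as parts are
typically of order `√n`. -/
theorem eventually_le_sum_logOneAddExpNeg {β θ η : ℝ} (hβ : 0 < β) (hθ : 0 < θ) (hη : 0 < η) :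
    ∀ᶠ n : ℕ in atTop, (shapeConst ^ 2 / (2 * β) - η) * √(n : ℝ) ≤
      ∑ j ∈ Finset.Icc 1 ⌊θ * n⌋₊, logOneAddExpNeg (β / √(n : ℝ) * j) := by
  have htail : Tendsto (fun n : ℕ => Real.exp (β - β * θ * √(n : ℝ)) / β) atTop (𝓝 (0 / β)) := by
    refine Tendsto.div_const (Real.tendsto_exp_atBot.comp ?_) β
    refine tendsto_atBot_add_const_left _ β ?_ |>.congr fun n => (sub_eq_add_neg _ _).symm
    exact tendsto_neg_atTop_atBot.comp
      (tendsto_sqrt_natCast_atTop.const_mul_atTop (by positivity))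
  rw [zero_div] at htail
  filter_upwards [(tendsto_tsum_logOneAddExpNeg_div_sqrt hβ).eventually_const_le
    (sub_lt_self _ (half_pos hη)), htail.eventually_le_const (half_pos hη),
    eventually_gt_atTop 0] with n hn ht hn0
  have hn1 : (1 : ℝ) ≤ n := by exact_mod_cast hn0
  have hs : 0 < √(n : ℝ) := Real.sqrt_pos.2 (by linarith)
  have hs1 : 1 ≤ √(n : ℝ) := Real.one_le_sqrt.2 hn1
  have hss : √(n : ℝ) * √(n : ℝ) = n := Real.mul_self_sqrt (by linarith)
  rw [le_div_iff₀ hs] at hn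
  have h1 := tsum_logOneAddExpNeg_le (div_pos hβ hs) ⌊θ * n⌋₊
  have h2 : Real.exp (-(β / √(n : ℝ) * ⌊θ * n⌋₊)) / (β / √(n : ℝ)) ≤ η / 2 * √(n : ℝ) := by
    rw [div_div_eq_mul_div, mul_div_right_comm]
    refine mul_le_mul_of_nonneg_right (le_trans ?_ ht) hs.le
    gcongr
    have h3 : θ * n - 1 ≤ ⌊θ * n⌋₊ := (Nat.sub_one_lt_floor _).le
    have h4 : β / √(n : ℝ) * (θ * n - 1) ≤ β / √(n : ℝ) * ⌊θ * n⌋₊ := by gcongr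
    have h5 : β / √(n : ℝ) * (θ * n - 1) = β * θ * √(n : ℝ) - β / √(n : ℝ) := by
      field_simp
      rw [pow_two, hss]
      ring
    have h6 : β / √(n : ℝ) ≤ β := div_le_self hβ.le hs1
    linarith
  linarith

theorem filter_Icc_one_eq_Ico (n : ℕ) (z : ℝ) :
    (Finset.Icc 1 n).filter (fun j : ℕ => z ≤ (j : ℝ)) = Finset.Ico (max 1 ⌈z⌉₊) (n + 1) := by
  ext j
  simp only [Finset.mem_filter, Finset.mem_Icc, Finset.mem_Ico, max_le_iff, Nat.ceil_le,
    Nat.lt_succ_iff]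
  tauto

/-- In the Boltzmann model of parameter `b = π / √(6 n)`, in which each `j ≤ n` is a part with
probability `1 / (1 + e^{bj})`, the expected number of parts `≥ y √n` is
`halfWidth y * √n + o(√n)`. -/
theorem eventually_abs_sum_sub_halfWidth_le {y η : ℝ} (hy : 0 ≤ y) (hη : 0 < η) :
    ∀ᶠ n : ℕ in atTop,
      |∑ j ∈ (Finset.Icc 1 n).filter (fun j : ℕ => y * √(n : ℝ) ≤ (j : ℝ)),
        1 / (1 + Real.exp (shapeConst / √(n : ℝ) * j)) - halfWidth y * √(n : ℝ)| ≤
        η * √(n : ℝ) := by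
  have hc := shapeConst_pos
  have hlim1 : Tendsto (fun n : ℕ => 1 / √(n : ℝ)) atTop (𝓝 0) :=
    tendsto_sqrt_natCast_atTop.const_div_atTop 1
  have hlim2 : Tendsto (fun n : ℕ => Real.exp (-(shapeConst * √(n : ℝ))) / shapeConst) atTop
      (𝓝 (0 / shapeConst)) := by
    refine Tendsto.div_const (Real.tendsto_exp_atBot.comp ?_) _
    exact tendsto_neg_atTop_atBot.comp (tendsto_sqrt_natCast_atTop.const_mul_atTop hc)
  rw [zero_div] at hlim2
  filter_upwards [hlim1.eventually_le_const (half_pos hη), hlim2.eventually_le_const (half_pos hη),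
    tendsto_sqrt_natCast_atTop.eventually_ge_atTop y, eventually_gt_atTop 0] with n h1 h2 h3 hn0
  have hn1 : (1 : ℝ) ≤ n := by exact_mod_cast hn0
  have hs : 0 < √(n : ℝ) := Real.sqrt_pos.2 (by linarith)
  have hss : √(n : ℝ) * √(n : ℝ) = n := Real.mul_self_sqrt (by linarith)
  rw [filter_Icc_one_eq_Ico]
  set Y := max 1 ⌈y * √(n : ℝ)⌉₊ with hY
  set b := shapeConst / √(n : ℝ) with hb
  have hb0 : 0 < b := div_pos hc hs
  have hbs : b * √(n : ℝ) = shapeConst := div_mul_cancel₀ _ hs.ne'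
  have hYn : Y ≤ n + 1 := by
    refine max_le (by omega) (Nat.ceil_le.2 ?_)
    push_cast
    nlinarith
  have hY1 : (y * √(n : ℝ)) ≤ Y := (Nat.le_ceil _).trans (by exact_mod_cast le_max_right _ _)
  have hY2 : (Y : ℝ) ≤ y * √(n : ℝ) + 1 := by
    rw [hY, Nat.cast_max, max_le_iff]
    refine ⟨?_, (Nat.ceil_lt_add_one (by positivity)).le⟩
    push_cast
    have : 0 ≤ y * √(n : ℝ) := by positivity
    linarith
  have hup := mul_sum_Ico_le b hYn
  have hlo := le_mul_sum_Ico b hYn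
  set S := ∑ j ∈ Finset.Ico Y (n + 1), 1 / (1 + Real.exp (b * j))
  have e1 : b * (y * √(n : ℝ)) = shapeConst * y := by rw [← hbs]; ring
  have hlo1 : logOneAddExpNeg (shapeConst * y) - b ≤ logOneAddExpNeg (b * Y) := by
    refine (logOneAddExpNeg_sub_le_self _ hb0.le).trans (antitone_logOneAddExpNeg ?_)
    nlinarith
  have hup1 : logOneAddExpNeg (b * (Y - 1)) - b ≤ logOneAddExpNeg (shapeConst * y) := by
    refine (logOneAddExpNeg_sub_le_self _ hb0.le).trans (antitone_logOneAddExpNeg ?_)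
    nlinarith
  have hlo2 : logOneAddExpNeg (b * (n + 1 : ℕ)) ≤ Real.exp (-(shapeConst * √(n : ℝ))) := by
    refine (antitone_logOneAddExpNeg ?_).trans (logOneAddExpNeg_le _)
    push_cast
    nlinarith
  have hg : halfWidth y * √(n : ℝ) * b = logOneAddExpNeg (shapeConst * y) := by
    rw [mul_assoc, mul_comm _ b, hbs, halfWidth, div_mul_cancel₀ _ hc.ne']
  have h1' : b ≤ η / 2 * shapeConst := by
    rw [hb, div_eq_mul_one_div, mul_comm]; gcongr
  rw [div_le_iff₀ hc] at h2
  have hfin : |(S - halfWidth y * √(n : ℝ)) * b| ≤ η * √(n : ℝ) * b := by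
    rw [mul_assoc η, mul_comm (√(n : ℝ)) b, hbs, sub_mul, hg, mul_comm S]
    rw [abs_le]
    constructor <;> linarith
  rw [abs_mul, abs_of_pos hb0] at hfin
  exact le_of_mul_le_mul_right hfin hb0

/-! ### Boltzmann weights and Chernoff bounds -/

/-- The pairs of sets of integers in `[1, K]`. -/
def setPairs (K : ℕ) : Finset (Finset ℕ × Finset ℕ) :=
  (Finset.Icc 1 K).powerset ×ˢ (Finset.Icc 1 K).powerset

/-- The sum of all elements of two sets of integers. -/
def pairSum (p : Finset ℕ × Finset ℕ) : ℕ := ∑ a ∈ p.1, a + ∑ a ∈ p.2, a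

theorem exp_neg_mul_sum (b : ℝ) (A : Finset ℕ) :
    Real.exp (-(b * (∑ a ∈ A, a : ℕ))) = ∏ a ∈ A, Real.exp (-(b * a)) := by
  rw [← Real.exp_sum]
  push_cast
  rw [Finset.mul_sum, Finset.sum_neg_distrib]

theorem prod_one_add_exp (b : ℝ) (s : Finset ℕ) :
    ∏ j ∈ s, (1 + Real.exp (-(b * j))) = Real.exp (∑ j ∈ s, logOneAddExpNeg (b * j)) := by
  rw [Real.exp_sum]
  refine Finset.prod_congr rfl fun j _ => ?_
  rw [logOneAddExpNeg, Real.exp_log (by positivity)]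

/-- The partition function of the Boltzmann model, in which a pair `p` of sets has weight
`e^{-b * pairSum p}`. -/
theorem sum_exp_pairSum (b : ℝ) (K : ℕ) :
    ∑ p ∈ setPairs K, Real.exp (-(b * pairSum p)) =
      Real.exp (2 * ∑ j ∈ Finset.Icc 1 K, logOneAddExpNeg (b * j)) := by
  have h : ∀ p ∈ setPairs K, Real.exp (-(b * pairSum p)) =
      (∏ a ∈ p.1, Real.exp (-(b * a))) * ∏ a ∈ p.2, Real.exp (-(b * a)) := fun p _ => by
    rw [← exp_neg_mul_sum, ← exp_neg_mul_sum, ← Real.exp_add, pairSum]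
    congr 1
    push_cast
    ring
  rw [Finset.sum_congr rfl h, setPairs, Finset.sum_product, two_mul, Real.exp_add,
    ← prod_one_add_exp, Finset.prod_one_add]
  simp_rw [← Finset.mul_sum, ← Finset.sum_mul]

/-- The exponential moment, in the Boltzmann model, of the number of elements `≥ Y` of the first of
the two sets. The bound comes from `(1 + e^t u) / (1 + u) = 1 + (e^t - 1) / (1 + u⁻¹)` and
`1 + z ≤ e^z`, with `u = e^{-bj}`. -/
theorem sum_exp_countGE_le (b t Y : ℝ) (n : ℕ) :
    ∑ p ∈ setPairs n, Real.exp (t * countGE p.1 Y - b * pairSum p) ≤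
      Real.exp (2 * ∑ j ∈ Finset.Icc 1 n, logOneAddExpNeg (b * j) +
        (Real.exp t - 1) * ∑ j ∈ (Finset.Icc 1 n).filter (fun j : ℕ => Y ≤ (j : ℝ)),
          1 / (1 + Real.exp (b * j))) := by
  set w : ℕ → ℝ := fun j => if Y ≤ (j : ℝ) then t else 0 with hw
  have hcount : ∀ A : Finset ℕ, t * countGE A Y = ∑ a ∈ A, w a := fun A => by
    rw [countGE, hw, Finset.sum_ite, Finset.sum_const_zero, add_zero, Finset.sum_const,
      nsmul_eq_mul, mul_comm]
  have h : ∀ p ∈ setPairs n, Real.exp (t * countGE p.1 Y - b * pairSum p) =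
      (∏ a ∈ p.1, Real.exp (w a - b * a)) * ∏ a ∈ p.2, Real.exp (-(b * a)) := fun p _ => by
    rw [← exp_neg_mul_sum, ← Real.exp_sum, ← Real.exp_add, pairSum, hcount,
      Finset.sum_sub_distrib, ← Finset.mul_sum]
    congr 1
    push_cast
    ring
  have hfac : ∀ j ∈ Finset.Icc 1 n, 1 + Real.exp (w j - b * j) ≤ (1 + Real.exp (-(b * j))) *
      Real.exp (if Y ≤ (j : ℝ) then (Real.exp t - 1) * (1 / (1 + Real.exp (b * j))) else 0) := by
    intro j _
    have hx := Real.exp_pos (b * j)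
    by_cases hj : Y ≤ (j : ℝ)
    · simp only [hw, if_pos hj]
      refine le_trans (le_of_eq ?_) (mul_le_mul_of_nonneg_left (Real.add_one_le_exp _)
        (by positivity))
      rw [sub_eq_add_neg, Real.exp_add, Real.exp_neg]
      field_simp
      ring
    · simp [hw, if_neg hj]
  rw [Finset.sum_congr rfl h, setPairs, Finset.sum_product]
  simp_rw [← Finset.mul_sum, ← Finset.sum_mul]
  rw [← Finset.prod_one_add, ← Finset.prod_one_add]
  refine (mul_le_mul_of_nonneg_right (Finset.prod_le_prod (fun j _ => by positivity) hfac)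
    (Finset.prod_nonneg fun j _ => by positivity)).trans (le_of_eq ?_)
  rw [Finset.prod_mul_distrib, prod_one_add_exp, ← Real.exp_sum, ← Finset.sum_filter,
    ← Finset.mul_sum, ← Real.exp_add, ← Real.exp_add]
  congr 1
  ring

open Classical in
/-- Chernoff's bound. A positive `t` bounds the number of pairs with `countGE p.1 Y ≥ r`, a
negative `t` that of the pairs with `countGE p.1 Y ≤ r`. -/
theorem card_filter_countGE_le {b : ℝ} (hb : 0 ≤ b) (t r Y : ℝ) (n : ℕ) :
    (((setPairs n).filter fun p => pairSum p ≤ n ∧ t * r ≤ t * countGE p.1 Y).card : ℝ) ≤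
      Real.exp (b * n - t * r + 2 * ∑ j ∈ Finset.Icc 1 n, logOneAddExpNeg (b * j) +
        (Real.exp t - 1) * ∑ j ∈ (Finset.Icc 1 n).filter (fun j : ℕ => Y ≤ (j : ℝ)),
          1 / (1 + Real.exp (b * j))) := by
  rw [add_assoc, Real.exp_add]
  refine le_trans ?_ (mul_le_mul_of_nonneg_left (sum_exp_countGE_le b t Y n) (Real.exp_pos _).le)
  rw [Finset.card_eq_sum_ones, Nat.cast_sum, Finset.mul_sum]
  refine (Finset.sum_le_sum fun p hp => ?_).trans
    (Finset.sum_le_sum_of_subset_of_nonneg (Finset.filter_subset _ _) fun p _ _ => by positivity)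
  obtain ⟨-, h1, h2⟩ := Finset.mem_filter.1 hp
  rw [← Real.exp_add, Nat.cast_one, Real.one_le_exp_iff]
  have h3 : (pairSum p : ℝ) ≤ n := by exact_mod_cast h1
  nlinarith

/-- The number of elements `≥ y √n` of `S` differs from the value `halfWidth y * √n` predicted by
the limit shape by at least `δ √n`. -/
def Deviates (n : ℕ) (δ y : ℝ) (S : Finset ℕ) : Prop :=
  δ * √(n : ℝ) ≤ |countGE S (y * √(n : ℝ)) - halfWidth y * √(n : ℝ)|

open Classical in
/-- The pairs of sets deviating from the limit shape at height `y` are rarer, by a factor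
exponentially small in `√n`, than `exp (2 π / √6 * √n)`. -/
theorem exists_eventually_card_deviation_le {y δ : ℝ} (hy : 0 ≤ y) (hδ : 0 < δ) :
    ∃ η > 0, ∀ᶠ n : ℕ in atTop,
      (((setPairs n).filter fun p => pairSum p ≤ n ∧ Deviates n δ y p.1).card : ℝ) ≤
        2 * Real.exp ((2 * shapeConst - η) * √(n : ℝ)) := by
  have hc := shapeConst_pos
  have hg := halfWidth_nonneg y
  set g := halfWidth y
  -- `s` balances the gain `s * δ` against the second order loss `s ^ 2 * g`.
  set s := min 1 (δ / (2 * (g + 1)))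
  have hs0 : 0 < s := lt_min one_pos (by positivity)
  have hs1 : s ≤ 1 := min_le_left _ _
  have hsg : s * g ≤ δ / 2 := by
    have h1 : s ≤ δ / (2 * (g + 1)) := min_le_right _ _
    rw [le_div_iff₀ (by positivity)] at h1
    nlinarith
  have hη : 0 < s * δ / 16 := by positivity
  refine ⟨s * δ / 4, by positivity, ?_⟩
  filter_upwards [eventually_sum_logOneAddExpNeg_le hc hη,
    eventually_abs_sum_sub_halfWidth_le hy hη, eventually_gt_atTop 0] with n h1 h2 hn0
  have hn1 : (1 : ℝ) ≤ n := by exact_mod_cast hn0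
  have hsn : 0 < √(n : ℝ) := Real.sqrt_pos.2 (by linarith)
  have hss : √(n : ℝ) * √(n : ℝ) = n := Real.mul_self_sqrt (by linarith)
  have h1 := h1 n
  have hb : 0 ≤ shapeConst / √(n : ℝ) := by positivity
  have hbn : shapeConst / √(n : ℝ) * n = shapeConst * √(n : ℝ) := by
    field_simp
    rw [pow_two, hss]
  have hcc : shapeConst ^ 2 / (2 * shapeConst) = shapeConst / 2 := by field_simp
  rw [hcc] at h1
  have key : ∀ t r : ℝ, |t| = s → t * r = (t * g + s * δ) * √(n : ℝ) →
      (((setPairs n).filter fun p => pairSum p ≤ n ∧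
        t * r ≤ t * countGE p.1 (y * √(n : ℝ))).card : ℝ) ≤
        Real.exp ((2 * shapeConst - s * δ / 4) * √(n : ℝ)) := by
    intro t r ht hr
    refine (card_filter_countGE_le hb t r (y * √(n : ℝ)) n).trans (Real.exp_le_exp.2 ?_)
    rw [hbn, hr]
    set S := ∑ j ∈ (Finset.Icc 1 n).filter (fun j : ℕ => y * √(n : ℝ) ≤ (j : ℝ)),
        1 / (1 + Real.exp (shapeConst / √(n : ℝ) * j))
    have e1 : |Real.exp t - 1| ≤ 2 := (Real.abs_exp_sub_one_le (by linarith)).trans (by linarith)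
    have e2 : Real.exp t - 1 - t ≤ s ^ 2 := by
      have := (le_abs_self _).trans (Real.abs_exp_sub_one_sub_id_le (x := t) (by linarith))
      rwa [← sq_abs, ht] at this
    have e3 : (Real.exp t - 1) * (S - g * √(n : ℝ)) ≤ 2 * (s * δ / 16 * √(n : ℝ)) := by
      refine (le_abs_self _).trans ?_
      rw [abs_mul]
      exact mul_le_mul e1 h2 (abs_nonneg _) (by norm_num)
    have e4 : (Real.exp t - 1 - t) * g ≤ s * δ / 2 := by nlinarith
    have e5 := mul_le_mul_of_nonneg_right e4 hsn.le
    linarith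
  have k1 := key s (g * √(n : ℝ) + δ * √(n : ℝ)) (abs_of_pos hs0) (by ring)
  have k2 := key (-s) (g * √(n : ℝ) - δ * √(n : ℝ)) (by rw [abs_neg, abs_of_pos hs0]) (by ring)
  refine le_trans ?_ ((add_le_add k1 k2).trans (two_mul _).ge)
  rw [← Nat.cast_add]
  refine Nat.cast_le.2 ((Finset.card_le_card fun p hp => ?_).trans (Finset.card_union_le _ _))
  simp only [Finset.mem_union, Finset.mem_filter] at hp ⊢
  obtain ⟨hp1, hp2, hp3⟩ := hp
  rcases le_abs.1 hp3 with h | h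
  · exact Or.inl ⟨hp1, hp2, mul_le_mul_of_nonneg_left (by linarith) hs0.le⟩
  · exact Or.inr ⟨hp1, hp2, mul_le_mul_of_nonpos_left (by linarith) (by linarith)⟩

/-! ### Lower bound for the number of strongly unimodal sequences -/

/-- Exponential Markov inequality for the sum of all parts, by a change of the parameter from `b`
to `b'`. -/
theorem sum_exp_pairSum_le_of_subset {b b' M : ℝ} {K : ℕ} {T : Finset (Finset ℕ × Finset ℕ)}
    (hT : T ⊆ setPairs K) (h : ∀ p ∈ T, 0 ≤ (b' - b) * (M - pairSum p)) :
    ∑ p ∈ T, Real.exp (-(b * pairSum p)) ≤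
      Real.exp ((b' - b) * M + 2 * ∑ j ∈ Finset.Icc 1 K, logOneAddExpNeg (b' * j)) := by
  rw [Real.exp_add, ← sum_exp_pairSum, Finset.mul_sum]
  refine (Finset.sum_le_sum fun p hp => ?_).trans
    (Finset.sum_le_sum_of_subset_of_nonneg hT fun p _ _ => by positivity)
  rw [← Real.exp_add]
  have := h p hp
  exact Real.exp_le_exp.2 (by linarith)

open Classical in
/-- The weights of the pairs with sum above `M`, with sum below `m`, and with sum between the two
add up to the partition function; the first two are bounded by changes of the parameter to `b₁`
and `b₂`, the third by a number of pairs. -/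
theorem sum_exp_pairSum_le_add_add (b m M : ℝ) (hb : 0 ≤ b) {b₁ b₂ : ℝ} (h₁ : b₁ ≤ b)
    (h₂ : b ≤ b₂) (K : ℕ) :
    Real.exp (2 * ∑ j ∈ Finset.Icc 1 K, logOneAddExpNeg (b * j)) ≤
      Real.exp ((b₁ - b) * M + 2 * ∑ j ∈ Finset.Icc 1 K, logOneAddExpNeg (b₁ * j)) +
      Real.exp ((b₂ - b) * m + 2 * ∑ j ∈ Finset.Icc 1 K, logOneAddExpNeg (b₂ * j)) +
      ((setPairs K).filter fun p => (pairSum p : ℝ) ≤ M).card * Real.exp (-(b * m)) := by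
  set T₁ := (setPairs K).filter fun p => M < (pairSum p : ℝ)
  set T₂ := (setPairs K).filter fun p => (pairSum p : ℝ) < m
  set T₃ := (setPairs K).filter fun p => m ≤ (pairSum p : ℝ) ∧ (pairSum p : ℝ) ≤ M
  set T₄ := (setPairs K).filter fun p => (pairSum p : ℝ) ≤ M
  have hcov : setPairs K ⊆ T₁ ∪ T₂ ∪ T₃ := fun p hp => by
    simp only [T₁, T₂, T₃, Finset.mem_union, Finset.mem_filter, hp, true_and]
    rcases lt_or_ge M (pairSum p : ℝ) with h | h
    · exact Or.inl (Or.inl h)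
    · rcases lt_or_ge (pairSum p : ℝ) m with h' | h'
      · exact Or.inl (Or.inr h')
      · exact Or.inr ⟨h', h⟩
  have hunion : ∀ (s t : Finset (Finset ℕ × Finset ℕ)),
      ∑ p ∈ s ∪ t, Real.exp (-(b * pairSum p)) ≤
        ∑ p ∈ s, Real.exp (-(b * pairSum p)) + ∑ p ∈ t, Real.exp (-(b * pairSum p)) := by
    intro s t
    rw [← Finset.sum_union_inter]
    exact le_add_of_nonneg_right (Finset.sum_nonneg fun p _ => by positivity)
  rw [← sum_exp_pairSum]
  refine (Finset.sum_le_sum_of_subset_of_nonneg hcov fun p _ _ => by positivity).trans ?_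
  refine (hunion _ _).trans (add_le_add ((hunion _ _).trans (add_le_add ?_ ?_)) ?_)
  · refine sum_exp_pairSum_le_of_subset (Finset.filter_subset _ _) fun p hp => ?_
    have := (Finset.mem_filter.1 hp).2
    exact mul_nonneg_of_nonpos_of_nonpos (by linarith) (by linarith)
  · refine sum_exp_pairSum_le_of_subset (Finset.filter_subset _ _) fun p hp => ?_
    have := (Finset.mem_filter.1 hp).2
    exact mul_nonneg (by linarith) (by linarith)
  · have h34 : T₃ ⊆ T₄ := Finset.monotone_filter_right _ fun p _ hp => hp.2
    calc ∑ p ∈ T₃, Real.exp (-(b * pairSum p)) ≤ T₃.card • Real.exp (-(b * m)) := by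
          refine Finset.sum_le_card_nsmul _ _ _ fun p hp => Real.exp_le_exp.2 ?_
          have := (Finset.mem_filter.1 hp).2.1
          nlinarith
      _ = T₃.card * Real.exp (-(b * m)) := nsmul_eq_mul _ _
      _ ≤ T₄.card * Real.exp (-(b * m)) := by
          have := Finset.card_le_card h34
          gcongr

theorem finite_stronglyUnimodal (n : ℕ) : (stronglyUnimodal n).Finite := Set.toFinite _

open Classical in
theorem card_setPairs_le_ncard {n K : ℕ} {M : ℝ} (h : M + K < n) :
    ((setPairs K).filter fun p => (pairSum p : ℝ) ≤ M).card ≤ (stronglyUnimodal n).ncard := by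
  rw [← Set.ncard_coe_finset]
  refine (Set.ncard_le_ncard (t := (fun c => (leftParts c, rightParts c)) '' stronglyUnimodal n)
    ?_ ((finite_stronglyUnimodal n).image _)).trans (Set.ncard_image_le (finite_stronglyUnimodal n))
  rintro ⟨A, B⟩ hp
  simp only [Finset.coe_filter, Set.mem_ofPred_eq, setPairs, Finset.mem_product,
    Finset.mem_powerset] at hp
  obtain ⟨⟨hA, hB⟩, hs⟩ := hp
  have h' : pairSum (A, B) + K < n := by
    have : (pairSum (A, B) : ℝ) + K < n := by linarith
    exact_mod_cast this
  obtain ⟨c, hc, h1, h2⟩ := exists_mem_stronglyUnimodal hA hB h'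
  exact ⟨c, hc, by simp [h1, h2]⟩

/-- The exponent of the bound for the tails of the sum of all parts: it is
`2 * c * z - c / x * z ^ 2 = c * x - c / x * (x - z) ^ 2`, up to the error terms. -/
theorem tail_exponent_le {c x z ρ s T : ℝ} (hx : 0 < x) (hz : 0 < z) (hs : 0 < s) (hρ : 0 ≤ ρ)
    (hgap : 6 * ρ ≤ c / x * (x - z) ^ 2) (hT : T ≤ (c * z / 2 + ρ) * s) :
    (c / z / s - c / x / s) * (z ^ 2 * s ^ 2) + 2 * T ≤ (c * x - 3 * ρ) * s := by
  have e1 : (c / z / s - c / x / s) * (z ^ 2 * s ^ 2) =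
      (c * x - c / x * (x - z) ^ 2 - c * z) * s := by
    field_simp
    ring
  have e2 : (c * x - c / x * (x - z) ^ 2 - c * z + 2 * (c * z / 2 + ρ)) * s ≤
      (c * x - 3 * ρ) * s :=
    mul_le_mul_of_nonneg_right (by linarith) hs.le
  rw [e1]
  linarith

/-- The lower bound `d(n) ≥ exp ((2 π / √6 - η) √n)` for `n` large. -/
theorem eventually_exp_le_ncard {η : ℝ} (hη : 0 < η) :
    ∀ᶠ n : ℕ in atTop, Real.exp ((2 * shapeConst - η) * √(n : ℝ)) ≤
      (stronglyUnimodal n).ncard := by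
  have hc := shapeConst_pos
  set c := shapeConst
  set θ := min (1 / 10) (η / (16 * c))
  have hθ0 : 0 < θ := lt_min (by norm_num) (by positivity)
  have hθ1 : θ ≤ 1 / 10 := min_le_left _ _
  have hθc : 8 * θ * c ≤ η / 2 := by
    have : θ ≤ η / (16 * c) := min_le_right _ _
    rw [le_div_iff₀ (by positivity)] at this
    linarith
  -- In the model of parameter `c / (x √n)` the total is about `x ^ 2 * n`, and it lies in
  -- `[w ^ 2 * n, u ^ 2 * n]` up to an event of exponentially small weight; the parameters
  -- `c / (u √n)` and `c / (w √n)` give the best bounds for that event.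
  obtain ⟨u, hu⟩ : ∃ u, u = 1 - θ := ⟨_, rfl⟩
  obtain ⟨x, hx⟩ : ∃ x, x = 1 - 2 * θ := ⟨_, rfl⟩
  obtain ⟨w, hw⟩ : ∃ w, w = 1 - 3 * θ := ⟨_, rfl⟩
  have hu0 : 0 < u := by linarith
  have hx0 : 0 < x := by linarith
  have hw0 : 0 < w := by linarith
  have hgap : 0 < c / x * θ ^ 2 := by positivity
  set ρ := min (c / x * θ ^ 2) η / 6 with hρ
  have hρ0 : 0 < ρ := div_pos (lt_min hgap hη) (by norm_num)
  have hρ1 : 6 * ρ ≤ c / x * θ ^ 2 := by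
    rw [hρ, mul_div_cancel₀ _ (by norm_num)]; exact min_le_left _ _
  have hρ2 : 6 * ρ ≤ η := by
    rw [hρ, mul_div_cancel₀ _ (by norm_num)]; exact min_le_right _ _
  have hexp : Tendsto (fun n : ℕ => Real.exp (ρ * √(n : ℝ))) atTop atTop :=
    Real.tendsto_exp_atTop.comp (tendsto_sqrt_natCast_atTop.const_mul_atTop hρ0)
  filter_upwards [eventually_le_sum_logOneAddExpNeg (β := c / x) (by positivity) hθ0 hρ0,
    eventually_sum_logOneAddExpNeg_le (β := c / u) (by positivity) hρ0,
    eventually_sum_logOneAddExpNeg_le (β := c / w) (by positivity) hρ0,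
    hexp.eventually_ge_atTop 3, eventually_gt_atTop 0] with n h1 h2 h3 h4 hn0
  have hn1 : (1 : ℝ) ≤ n := by exact_mod_cast hn0
  have hsn : 0 < √(n : ℝ) := Real.sqrt_pos.2 (by linarith)
  set K := ⌊θ * n⌋₊
  have h2 := h2 K
  have h3 := h3 K
  have ediv : ∀ z : ℝ, 0 < z → c ^ 2 / (2 * (c / z)) = c * z / 2 := fun z hz => by
    field_simp
  rw [ediv x hx0] at h1
  rw [ediv u hu0] at h2
  rw [ediv w hw0] at h3
  have hmono : ∀ z z' : ℝ, 0 < z → z ≤ z' → c / z' / √(n : ℝ) ≤ c / z / √(n : ℝ) :=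
    fun z z' hz hzz => by gcongr
  have hsplit := sum_exp_pairSum_le_add_add (c / x / √(n : ℝ)) (w ^ 2 * n) (u ^ 2 * n)
    (by positivity) (hmono x u hx0 (by linarith)) (hmono w x hw0 (by linarith)) K
  have t1 := Real.exp_le_exp.2 (tail_exponent_le hx0 hu0 hsn hρ0.le
    (hρ1.trans_eq (by rw [hx, hu]; ring)) h2)
  have t2 := Real.exp_le_exp.2 (tail_exponent_le hx0 hw0 hsn hρ0.le
    (hρ1.trans_eq (by rw [hx, hw]; ring)) h3)
  rw [Real.sq_sqrt (by linarith)] at t1 t2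
  have hmain : Real.exp ((c * x - 2 * ρ) * √(n : ℝ)) ≤
      Real.exp (2 * ∑ j ∈ Finset.Icc 1 K, logOneAddExpNeg (c / x / √(n : ℝ) * j)) :=
    Real.exp_le_exp.2 (by linarith)
  have h3exp : 3 * Real.exp ((c * x - 3 * ρ) * √(n : ℝ)) ≤
      Real.exp ((c * x - 2 * ρ) * √(n : ℝ)) := by
    rw [show (c * x - 2 * ρ) * √(n : ℝ) = ρ * √(n : ℝ) + (c * x - 3 * ρ) * √(n : ℝ) by ring,
      Real.exp_add]
    gcongr
  have hcard : (((setPairs K).filter fun p => (pairSum p : ℝ) ≤ u ^ 2 * n).card : ℝ) ≤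
      (stronglyUnimodal n).ncard := by
    refine Nat.cast_le.2 (card_setPairs_le_ncard ?_)
    have hKn : (K : ℝ) ≤ θ * n := Nat.floor_le (by positivity)
    have hu2 : u ^ 2 + θ < 1 := by rw [hu]; nlinarith
    nlinarith
  have hfin : Real.exp ((c * x - 3 * ρ) * √(n : ℝ)) ≤
      (stronglyUnimodal n).ncard * Real.exp (-(c / x / √(n : ℝ) * (w ^ 2 * n))) := by
    have := mul_le_mul_of_nonneg_right hcard
      (Real.exp_pos (-(c / x / √(n : ℝ) * (w ^ 2 * n)))).le
    linarith
  rw [Real.exp_neg, ← div_eq_mul_inv, le_div_iff₀ (Real.exp_pos _), ← Real.exp_add] at hfin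
  refine le_trans (Real.exp_le_exp.2 ?_) hfin
  have e3 : c / x / √(n : ℝ) * (w ^ 2 * n) = c * (w ^ 2 / x) * √(n : ℝ) := by
    field_simp
    rw [Real.sq_sqrt (by linarith)]
  have e4 : 1 - 6 * θ ≤ w ^ 2 / x := by
    rw [le_div_iff₀ hx0, hw, hx]
    linarith [mul_nonneg hθ0.le (sub_nonneg.2 hθ1)]
  have e5 : c * (1 - 6 * θ) ≤ c * (w ^ 2 / x) := mul_le_mul_of_nonneg_left e4 hc.le
  have hcx : c * x = c - 2 * θ * c := by rw [hx]; ring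
  have e6 : 2 * c - η ≤ c * x - 3 * ρ + c * (w ^ 2 / x) := by linarith
  rw [e3, ← add_mul]
  exact mul_le_mul_of_nonneg_right e6 hsn.le

/-! ### Proportion of sequences deviating at a given height -/

open Classical in
theorem ncard_le_card_filter {n : ℕ} {f : Composition n → Finset ℕ × Finset ℕ}
    (hf : Set.InjOn f (stronglyUnimodal n))
    (hmem : ∀ c ∈ stronglyUnimodal n, f c ∈ setPairs n ∧ pairSum (f c) ≤ n)
    (P : Finset ℕ × Finset ℕ → Prop) :
    {c ∈ stronglyUnimodal n | P (f c)}.ncard ≤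
      ((setPairs n).filter fun p => pairSum p ≤ n ∧ P p).card := by
  rw [← Set.ncard_coe_finset]
  refine Set.ncard_le_ncard_of_injOn f (fun c hc => ?_) (hf.mono fun c hc => hc.1)
    (Finset.finite_toSet _)
  exact Finset.mem_coe.2 (Finset.mem_filter.2 ⟨(hmem c hc.1).1, (hmem c hc.1).2, hc.2⟩)

/-- The deviations of the first component of `f n c` are negligible, for any injective encoding
`f n` of sequences of size `n` by pairs of sets; it is used for the parts left of the peak and for
those right of it. -/
theorem tendsto_ncard_deviates_div {δ y : ℝ} (hδ : 0 < δ) (hy : 0 ≤ y)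
    {f : ∀ n, Composition n → Finset ℕ × Finset ℕ}
    (hf : ∀ n, Set.InjOn (f n) (stronglyUnimodal n))
    (hmem : ∀ n, ∀ c ∈ stronglyUnimodal n, f n c ∈ setPairs n ∧ pairSum (f n c) ≤ n) :
    Tendsto (fun n : ℕ => ({c ∈ stronglyUnimodal n | Deviates n δ y (f n c).1}.ncard : ℝ) /
      (stronglyUnimodal n).ncard) atTop (𝓝 0) := by
  obtain ⟨η, hη, hev⟩ := exists_eventually_card_deviation_le hy hδ
  have hlim : Tendsto (fun n : ℕ => 2 * Real.exp (-(η / 2 * √(n : ℝ)))) atTop (𝓝 (2 * 0)) :=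
    Tendsto.const_mul 2 (Real.tendsto_exp_atBot.comp (tendsto_neg_atTop_atBot.comp
      (tendsto_sqrt_natCast_atTop.const_mul_atTop (half_pos hη))))
  rw [mul_zero] at hlim
  refine squeeze_zero' (Eventually.of_forall fun n => by positivity) ?_ hlim
  filter_upwards [hev, eventually_exp_le_ncard (half_pos hη)] with n h1 h2
  have hpos : (0 : ℝ) < (stronglyUnimodal n).ncard := (Real.exp_pos _).trans_le h2
  rw [div_le_iff₀ hpos]
  calc ({c ∈ stronglyUnimodal n | Deviates n δ y (f n c).1}.ncard : ℝ)
      ≤ 2 * Real.exp ((2 * shapeConst - η) * √(n : ℝ)) := by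
        exact le_trans (Nat.cast_le.2 (ncard_le_card_filter (hf n) (hmem n)
          fun p => Deviates n δ y p.1)) h1
    _ = 2 * Real.exp (-(η / 2 * √(n : ℝ))) *
          Real.exp ((2 * shapeConst - η / 2) * √(n : ℝ)) := by
        rw [mul_assoc, ← Real.exp_add]
        congr 2
        ring
    _ ≤ _ := by gcongr

theorem tendsto_ncard_leftParts_deviates_div {δ y : ℝ} (hδ : 0 < δ) (hy : 0 ≤ y) :
    Tendsto (fun n : ℕ => ({c ∈ stronglyUnimodal n | Deviates n δ y (leftParts c)}.ncard : ℝ) /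
      (stronglyUnimodal n).ncard) atTop (𝓝 0) :=
  tendsto_ncard_deviates_div (f := fun _ c => (leftParts c, rightParts c)) hδ hy injOn_parts
    fun _ c hc => ⟨Finset.mk_mem_product (Finset.mem_powerset.2 (parts_subset c).1)
      (Finset.mem_powerset.2 (parts_subset c).2), sum_parts_le hc⟩

theorem tendsto_ncard_rightParts_deviates_div {δ y : ℝ} (hδ : 0 < δ) (hy : 0 ≤ y) :
    Tendsto (fun n : ℕ => ({c ∈ stronglyUnimodal n | Deviates n δ y (rightParts c)}.ncard : ℝ) /
      (stronglyUnimodal n).ncard) atTop (𝓝 0) :=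
  tendsto_ncard_deviates_div (f := fun _ c => (rightParts c, leftParts c)) hδ hy
    (fun n _ hc _ hc' h => injOn_parts n hc hc' (Prod.swap_injective h))
    fun _ c hc => ⟨Finset.mk_mem_product (Finset.mem_powerset.2 (parts_subset c).2)
      (Finset.mem_powerset.2 (parts_subset c).1), (add_comm _ _).trans_le (sum_parts_le hc)⟩

/-! ### From finitely many heights to the whole shape -/

theorem antitone_countGE (S : Finset ℕ) : Antitone (countGE S) := fun _ _ h =>
  Finset.card_le_card (Finset.monotone_filter_right _ fun _ _ ha => h.trans ha)

theorem antitone_halfWidth : Antitone halfWidth := fun _ _ h =>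
  div_le_div_of_nonneg_right (antitone_logOneAddExpNeg
    (mul_le_mul_of_nonneg_left h shapeConst_pos.le)) shapeConst_pos.le

theorem halfWidth_sub_le {y z : ℝ} (h : y ≤ z) : halfWidth y - (z - y) ≤ halfWidth z := by
  have hc := shapeConst_pos
  have := logOneAddExpNeg_sub_le_self (shapeConst * y)
    (mul_nonneg hc.le (sub_nonneg.2 h))
  rw [← mul_add, add_sub_cancel] at this
  unfold halfWidth
  rw [le_div_iff₀ hc, sub_mul, div_mul_cancel₀ _ hc.ne']
  linarith

theorem exists_halfWidth_le {δ : ℝ} (hδ : 0 < δ) : ∃ I : ℕ, halfWidth (I * δ) ≤ δ := by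
  have hc := shapeConst_pos
  have hlim : Tendsto (fun I : ℕ => Real.exp (-(shapeConst * (I * δ))) / shapeConst) atTop
      (𝓝 (0 / shapeConst)) := by
    refine Tendsto.div_const (Real.tendsto_exp_atBot.comp ?_) _
    exact tendsto_neg_atTop_atBot.comp
      ((tendsto_natCast_atTop_atTop.atTop_mul_const hδ).const_mul_atTop hc)
  rw [zero_div] at hlim
  obtain ⟨I, hI⟩ := (hlim.eventually_le_const hδ).exists
  exact ⟨I, (div_le_div_of_nonneg_right (logOneAddExpNeg_le _) hc.le).trans hI⟩

/-- By monotonicity, closeness to the limit shape at the heights `i * δ` for `i ≤ I` gives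
closeness at all heights. -/
theorem abs_countGE_sub_le {n I : ℕ} {δ : ℝ} (hδ : 0 < δ) (hI : halfWidth (I * δ) ≤ δ)
    {S : Finset ℕ} (hS : ∀ i ∈ Finset.range (I + 1), ¬ Deviates n δ (i * δ) S) {y : ℝ}
    (hy : 0 ≤ y) :
    |countGE S (y * √(n : ℝ)) - halfWidth y * √(n : ℝ)| ≤ 2 * δ * √(n : ℝ) := by
  have hs : 0 ≤ √(n : ℝ) := Real.sqrt_nonneg _
  have hS' : ∀ i ≤ I, |countGE S (i * δ * √(n : ℝ)) - halfWidth (i * δ) * √(n : ℝ)| ≤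
      δ * √(n : ℝ) := fun i hi =>
    (not_le.1 (hS i (Finset.mem_range.2 (Nat.lt_succ_of_le hi)))).le
  have hN : ∀ z z' : ℝ, z ≤ z' →
      (countGE S (z' * √(n : ℝ)) : ℝ) ≤ countGE S (z * √(n : ℝ)) := fun z z' h =>
    Nat.cast_le.2 (antitone_countGE S (mul_le_mul_of_nonneg_right h hs))
  rcases le_or_gt (I * δ) y with h | h
  · have h1 := (abs_le.1 (hS' I le_rfl)).2
    have h2 := hN _ _ h
    have h3 := mul_le_mul_of_nonneg_right hI hs
    have h4 := mul_le_mul_of_nonneg_right ((antitone_halfWidth h).trans hI) hs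
    have h5 := mul_nonneg (halfWidth_nonneg y) hs
    have h6 : (0 : ℝ) ≤ countGE S (y * √(n : ℝ)) := Nat.cast_nonneg _
    rw [abs_le]
    constructor <;> linarith
  · set i := ⌊y / δ⌋₊
    have hi1 : i * δ ≤ y := by
      rw [← le_div_iff₀ hδ]; exact Nat.floor_le (by positivity)
    have hi2 : y ≤ (i + 1 : ℕ) * δ := by
      rw [← div_le_iff₀ hδ]; push_cast; exact (Nat.lt_floor_add_one _).le
    have hiI : i + 1 ≤ I := by
      have : (i : ℝ) < I := lt_of_mul_lt_mul_right (hi1.trans_lt h) hδ.le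
      exact_mod_cast this
    have h1 := (abs_le.1 (hS' i (by omega))).2
    have h2 := (abs_le.1 (hS' (i + 1) hiI)).1
    have h3 := hN _ _ hi1
    have h4 := hN _ _ hi2
    have e : ((i + 1 : ℕ) : ℝ) * δ = i * δ + δ := by push_cast; ring
    have h5 : halfWidth (i * δ) ≤ halfWidth y + δ := by
      have := halfWidth_sub_le hi1
      linarith
    have h6 : halfWidth y ≤ halfWidth ((i + 1 : ℕ) * δ) + δ := by
      have := halfWidth_sub_le hi2
      linarith
    have h5' := mul_le_mul_of_nonneg_right h5 hs
    have h6' := mul_le_mul_of_nonneg_right h6 hs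
    rw [abs_le]
    constructor <;> linarith

theorem halfWidth_pos (y : ℝ) : 0 < halfWidth y :=
  div_pos (Real.log_pos (by linarith [Real.exp_pos (-(shapeConst * y))])) shapeConst_pos

theorem halfWidth_le {y : ℝ} (hy : 0 ≤ y) : halfWidth y ≤ √6 / Real.pi * Real.log 2 := by
  refine (antitone_halfWidth hy).trans (le_of_eq ?_)
  rw [halfWidth, mul_zero, logOneAddExpNeg, neg_zero, Real.exp_zero, one_add_one_eq_two,
    shapeConst, div_div_eq_mul_div]
  ring

theorem neg_mul_log_exp_halfWidth_sub_one (y : ℝ) :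
    -(√6 / Real.pi) * Real.log (Real.exp (Real.pi / √6 * halfWidth y) - 1) = y := by
  have h6 : √6 ≠ 0 := by positivity
  have hpi := Real.pi_pos.ne'
  have e : Real.pi / √6 * halfWidth y = logOneAddExpNeg (shapeConst * y) :=
    mul_div_cancel₀ _ shapeConst_pos.ne'
  rw [e, logOneAddExpNeg, Real.exp_log (by positivity), add_sub_cancel_left, Real.log_exp,
    shapeConst]
  field_simp

theorem limitCurve_halfWidth (y : ℝ) : limitCurve (halfWidth y) = y := by
  rw [limitCurve, if_neg (halfWidth_pos y).le.not_gt, neg_mul_log_exp_halfWidth_sub_one]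

theorem limitCurve_neg_halfWidth (y : ℝ) : limitCurve (-halfWidth y) = y := by
  rw [limitCurve, if_pos (neg_lt_zero.2 (halfWidth_pos y)), neg_mul_neg,
    neg_mul_log_exp_halfWidth_sub_one]

theorem renormalizedShape_subset_shapeNhd {n I : ℕ} {c : Composition n} {δ : ℝ} (hδ : 0 < δ)
    (hc : c ∈ stronglyUnimodal n) (hI : halfWidth (I * δ) ≤ δ) (hn : 1 / δ ≤ √(n : ℝ))
    (hL : ∀ i ∈ Finset.range (I + 1), ¬ Deviates n δ (i * δ) (leftParts c))
    (hR : ∀ i ∈ Finset.range (I + 1), ¬ Deviates n δ (i * δ) (rightParts c)) :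
    renormalizedShape c ⊆ shapeNhd limitCurveDomain limitCurve (3 * δ) := by
  rintro _ ⟨⟨x, h⟩, hxh, rfl⟩
  have hs : 0 < √(n : ℝ) := lt_of_lt_of_le (by positivity) hn
  have hδs : 1 ≤ δ * √(n : ℝ) := by
    rwa [div_le_iff₀ hδ, mul_comm] at hn
  have hy : 0 ≤ h / √(n : ℝ) := div_nonneg (nonneg_of_mem_shape hxh) hs.le
  have hh : h = h / √(n : ℝ) * √(n : ℝ) := (div_mul_cancel₀ _ hs.ne').symm
  have hw0 := halfWidth_pos (h / √(n : ℝ))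
  have hw1 := halfWidth_le hy
  have kL := abs_countGE_sub_le hδ hI hL hy
  have kR := abs_countGE_sub_le hδ hI hR hy
  have hdiv : ∀ t : ℝ, |x - t * √(n : ℝ)| ≤ 3 * δ * √(n : ℝ) → |x / √(n : ℝ) - t| ≤ 3 * δ := by
    intro t ht
    rwa [div_sub' hs.ne', abs_div, abs_of_pos hs, div_le_iff₀ hs, mul_comm (√(n : ℝ)) t]
  rw [← hh] at kL kR
  rcases abs_le_one_or_of_mem_shape hc hxh with k | k | k
  · refine Or.inr ?_
    show |x / √(n : ℝ)| < 3 * δ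
    rw [abs_div, abs_of_pos hs, div_lt_iff₀ hs]
    nlinarith
  · refine Or.inl (Or.inl ⟨-halfWidth (h / √(n : ℝ)), Or.inl ⟨neg_le_neg hw1, by linarith⟩,
      limitCurve_neg_halfWidth _, hdiv _ ?_⟩)
    rw [abs_le] at k kL ⊢
    constructor <;> linarith
  · refine Or.inl (Or.inl ⟨halfWidth (h / √(n : ℝ)), Or.inr ⟨hw0, hw1⟩,
      limitCurve_halfWidth _, hdiv _ ?_⟩)
    rw [abs_le] at k kR ⊢
    constructor <;> linarith

theorem theorem1p1 (ε : ℝ) (hε : 0 < ε) :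
    Tendsto
      (fun n : ℕ =>
        (1 / ((stronglyUnimodal n).ncard : ℝ)) *
          (({c ∈ stronglyUnimodal n |
            renormalizedShape c ⊆ shapeNhd limitCurveDomain limitCurve ε}.ncard : ℕ) : ℝ))
      atTop (𝓝 1) := by
  obtain ⟨δ, hδ, rfl⟩ : ∃ δ > 0, ε = 3 * δ := ⟨ε / 3, by positivity, by ring⟩
  obtain ⟨I, hI⟩ := exists_halfWidth_le hδ
  set good : ∀ n, Set (Composition n) := fun n => {c ∈ stronglyUnimodal n |
    renormalizedShape c ⊆ shapeNhd limitCurveDomain limitCurve (3 * δ)}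
  set bad : ℕ → ℝ := fun n => ∑ i ∈ Finset.range (I + 1),
    (({c ∈ stronglyUnimodal n | Deviates n δ (i * δ) (leftParts c)}.ncard : ℝ) /
        (stronglyUnimodal n).ncard +
      ({c ∈ stronglyUnimodal n | Deviates n δ (i * δ) (rightParts c)}.ncard : ℝ) /
        (stronglyUnimodal n).ncard) with hbad
  have hbad0 : Tendsto (fun n => 1 - bad n) atTop (𝓝 1) := by
    have h0 : Tendsto bad atTop (𝓝 (∑ i ∈ Finset.range (I + 1), ((0 : ℝ) + 0))) :=
      tendsto_finsetSum _ fun i _ =>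
        (tendsto_ncard_leftParts_deviates_div hδ (by positivity)).add
          (tendsto_ncard_rightParts_deviates_div hδ (by positivity))
    have := h0.const_sub 1
    simpa using this
  refine tendsto_of_tendsto_of_tendsto_of_le_of_le' hbad0 tendsto_const_nhds ?_ ?_
  · filter_upwards [eventually_exp_le_ncard one_pos,
      tendsto_sqrt_natCast_atTop.eventually_ge_atTop (1 / δ)] with n h1 h2
    have hpos : (0 : ℝ) < (stronglyUnimodal n).ncard := (Real.exp_pos _).trans_le h1
    set B : ℕ → Set (Composition n) := fun i =>
      {c ∈ stronglyUnimodal n | Deviates n δ (i * δ) (leftParts c)} ∪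
      {c ∈ stronglyUnimodal n | Deviates n δ (i * δ) (rightParts c)}
    have hcov : stronglyUnimodal n ⊆ good n ∪ ⋃ i ∈ Finset.range (I + 1), B i := by
      intro c hc
      by_cases h : c ∈ ⋃ i ∈ Finset.range (I + 1), B i
      · exact Or.inr h
      · simp only [Set.mem_iUnion, not_exists] at h
        exact Or.inl ⟨hc, renormalizedShape_subset_shapeNhd hδ hc hI h2
          (fun i hi hd => h i hi (Or.inl ⟨hc, hd⟩)) fun i hi hd => h i hi (Or.inr ⟨hc, hd⟩)⟩
    have hcard : (stronglyUnimodal n).ncard ≤ (good n).ncard + ∑ i ∈ Finset.range (I + 1),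
        ({c ∈ stronglyUnimodal n | Deviates n δ (i * δ) (leftParts c)}.ncard +
          {c ∈ stronglyUnimodal n | Deviates n δ (i * δ) (rightParts c)}.ncard) := by
      refine (Set.ncard_le_ncard hcov (Set.toFinite _)).trans ((Set.ncard_union_le _ _).trans ?_)
      refine add_le_add le_rfl ((Finset.set_ncard_biUnion_le _ _).trans ?_)
      exact Finset.sum_le_sum fun i _ => Set.ncard_union_le _ _
    have hcard' : ((stronglyUnimodal n).ncard : ℝ) ≤
        (good n).ncard + bad n * (stronglyUnimodal n).ncard := by
      simp only [hbad, ← add_div, ← Finset.sum_div, div_mul_cancel₀ _ hpos.ne']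
      exact_mod_cast hcard
    rw [one_div_mul_eq_div, le_div_iff₀ hpos]
    linarith
  · refine Eventually.of_forall fun n => ?_
    rw [one_div_mul_eq_div]
    refine div_le_one_of_le₀ (Nat.cast_le.2 (Set.ncard_le_ncard (fun c hc => hc.1)
      (Set.toFinite _))) (Nat.cast_nonneg _)
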